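/- Let $(\mathcal M,g)$ be a four-dimensional Lorentzian manifold (signature $(-,+,+,+)$) with Levi-Civita connection $\nabla$, and let $\mathcal H\subset\mathcal M$ be a Killing horizon: a (smooth, immersed) null hypersurface with a Killing vector field $\xi$ of $\mathcal M$ that is nowhere zero on $\mathcal H$ and normal to $\mathcal H$. Let $\kappa:\mathcal H\to\mathbb R$ be the function with $\nabla_\xi\xi=\kappa\,\xi$ on $\mathcal H$. Let $\mathcal S=\langle S_0,L_{geod},\Omega=1\rangle$ be a geodesic foliation of $\mathcal H$: $L=L_{geod}$ is a smooth vector field on $\mathcal H$, normal (hence tangent) to $\mathcal H$, with $\nabla_LL=0$; the leaves $S_v$ are the level sets of a smooth function $v$ on $\mathcal H$ with $Lv=1$; the section $S_0=\{v=0\}$ meets every null generator, i.e. every point of $\mathcal H$ is joined to $S_0$ by an integral curve of $L$ in $\mathcal H$. Let $\underline L$ be the smooth null vector field along $\mathcal H$ that is normal to the leaves $S_v$ and satisfies $g(L,\underline L)=-1$. For $X,Y$ tangent to the leaves put $$\chi(X,Y)=g(\nabla_XL,Y),\quad \underline\chi(X,Y)=g(\nabla_X\underline L,Y),\quad \zeta(X)=g(\nabla_XL,\underline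 L),\quad \beta(X)=R(X,L,\underline L,L),$$ where $R(A,B,C,D)=g(R(C,D)B,A)$ and $R(C,D)B=\nabla_C\nabla_DB-\nabla_D\nabla_CB-\nabla_{[C,D]}B$; let $g\!\!\!/$ be the induced metric of the leaves. These tensors are extended by zero on $L$ and $\underline L$. Let $\mathcal L\!\!\!/_L$ and $\nabla\!\!\!\!/_L$ be the projections to the leaves of $\mathcal L_L$ and $\nabla_L$, and $d\!\!\!/$ the differential along the leaves. Then on $\mathcal H$: 1. $\chi=0$. 2. $\mathcal L\!\!\!/_L\, g\!\!\!/=0$. 3. $\kappa$ is differentiable and $d\!\!\!/\kappa=g(\xi,\underline L)\cdot\beta$. 4. $\mathcal L\!\!\!/_L\zeta=\nabla\!\!\!\!/_L\zeta=-\beta$. 5. If in addition $L=\xi$ on $S_0$ and $\kappa$ is constant on $\mathcal H$, then $\mathcal L\!\!\!/_L\underline\chi=\nabla\!\!\!\!/_L\underline\chi=\dfrac{\kappa}{f}\,\underline\chi$, where $f$ is the (nowhere vanishing) function on $\mathcal H$ with $\xi=f\cdot L$. -/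

import Mathlib

open scoped Manifold ContDiff Topology

noncomputable section

/-- The model space of spacetime. -/
abbrev E4 : Type := EuclideanSpace ℝ (Fin 4)

/-- The model space of a hypersurface in spacetime. -/
abbrev E3 : Type := EuclideanSpace ℝ (Fin 3)

section Spacetime

variable (M : Type*) [TopologicalSpace M] [ChartedSpace E4 M] [IsManifold (𝓡 4) ∞ M]

/-- A smooth Lorentzian metric on a four-dimensional manifold, of signature `(-,+,+,+)`. -/
structure LorentzMetric where
  /-- The scalar product on every tangent space. -/
  val : ∀ x : M, TangentSpace (𝓡 4) x →L[ℝ] TangentSpace (𝓡 4) x →L[ℝ] ℝ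
  symm : ∀ (x : M) (u w : TangentSpace (𝓡 4) x), val x u w = val x w u
  signature : ∀ x : M, ∃ b : Module.Basis (Fin 4) ℝ (TangentSpace (𝓡 4) x),
    ∀ i j, val x (b i) (b j) = if i = j then (if i = 0 then -1 else 1) else 0
  contMDiff : ContMDiff (𝓡 4) ((𝓡 4).prod 𝓘(ℝ, E4 →L[ℝ] E4 →L[ℝ] ℝ)) ∞
    (fun x ↦ Bundle.TotalSpace.mk' (E4 →L[ℝ] E4 →L[ℝ] ℝ) x (val x))

variable {M}

/-- Differentiability at `x` of a vector field on spacetime. -/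
abbrev FieldDiffAt (X : ∀ x : M, TangentSpace (𝓡 4) x) (x : M) : Prop :=
  MDifferentiableAt (𝓡 4) ((𝓡 4).prod 𝓘(ℝ, E4))
    (fun y ↦ Bundle.TotalSpace.mk' E4 (E := (TangentSpace (𝓡 4) : M → Type _)) y (X y)) x

end Spacetime

namespace LorentzMetric

variable {M : Type*} [TopologicalSpace M] [ChartedSpace E4 M] [IsManifold (𝓡 4) ∞ M]
  (g : LorentzMetric M)

lemma nondegenerate (x : M) (u : TangentSpace (𝓡 4) x) (hu : ∀ w, g.val x u w = 0) : u = 0 := by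
  obtain ⟨b, hb⟩ := g.signature x
  refine b.ext_elem fun j ↦ ?_
  have h := hu (b j)
  rw [← b.sum_repr u] at h
  simp only [map_sum, map_smul, _root_.sum_apply, _root_.smul_apply, hb,
    smul_eq_mul] at h
  simp only [mul_ite, mul_zero, Finset.sum_ite_eq', Finset.mem_univ, if_true] at h
  split_ifs at h <;> simpa using h

instance (x : M) : FiniteDimensional ℝ (TangentSpace (𝓡 4) x) :=
  inferInstanceAs (FiniteDimensional ℝ E4)

instance (x : M) : T2Space (TangentSpace (𝓡 4) x) := inferInstanceAs (T2Space E4)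

/-- The musical isomorphism: the vector `sharp x φ` is characterised by
`g (sharp x φ) w = φ w` for all `w`. -/
def sharp (x : M) : (TangentSpace (𝓡 4) x →ₗ[ℝ] ℝ) ≃ₗ[ℝ] TangentSpace (𝓡 4) x :=
  (LinearMap.linearEquivOfInjective
    (V := TangentSpace (𝓡 4) x) (V₂ := TangentSpace (𝓡 4) x →ₗ[ℝ] ℝ)
    ((ContinuousLinearMap.coeLM ℝ).comp (g.val x).toLinearMap)
    (by
      rw [← LinearMap.ker_eq_bot, LinearMap.ker_eq_bot']
      intro u hu
      exact g.nondegenerate x u fun w ↦ congrArg (fun φ : TangentSpace (𝓡 4) x →ₗ[ℝ] ℝ ↦ φ w) hu)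
    (Subspace.dual_finrank_eq (K := ℝ) (V := TangentSpace (𝓡 4) x)).symm).symm

lemma val_sharp (x : M) (φ : TangentSpace (𝓡 4) x →ₗ[ℝ] ℝ) (w : TangentSpace (𝓡 4) x) :
    g.val x (g.sharp x φ) w = φ w := by
  have h := (g.sharp x).symm_apply_apply φ
  exact congrArg (fun ψ : TangentSpace (𝓡 4) x →ₗ[ℝ] ℝ ↦ ψ w) h

/-- The function `g(X, Y)`. -/
def pair (X Y : ∀ x : M, TangentSpace (𝓡 4) x) (x : M) : ℝ := g.val x (X x) (Y x)

/-- The right-hand side of the Koszul formula for `2 g(∇_X Y, Z)`. -/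
def koszul (Y X Z : ∀ x : M, TangentSpace (𝓡 4) x) (x : M) : ℝ :=
  mvfderiv (𝓡 4) (g.pair Y Z) x (X x) + mvfderiv (𝓡 4) (g.pair X Z) x (Y x) - mvfderiv (𝓡 4) (g.pair X Y) x (Z x)
    + g.val x (VectorField.mlieBracket (𝓡 4) X Y x) (Z x)
    - g.val x (VectorField.mlieBracket (𝓡 4) X Z x) (Y x)
    - g.val x (VectorField.mlieBracket (𝓡 4) Y Z x) (X x)


variable {g}

lemma pair_comm (X Y : ∀ x : M, TangentSpace (𝓡 4) x) : g.pair X Y = g.pair Y X :=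
  funext fun x ↦ g.symm x (X x) (Y x)

lemma mdiff_pair {X Y : ∀ x : M, TangentSpace (𝓡 4) x} {x : M}
    (hX : FieldDiffAt X x) (hY : FieldDiffAt Y x) :
    MDifferentiableAt (𝓡 4) 𝓘(ℝ, ℝ) (g.pair X Y) x := by
  have h := (g.contMDiff.mdifferentiable (by simp) x).clm_bundle_apply₂
    (F₁ := E4) (F₂ := E4) (F₃ := ℝ) (E₁ := (TangentSpace (𝓡 4) : M → Type _))
    (E₂ := (TangentSpace (𝓡 4) : M → Type _)) (E₃ := Bundle.Trivial M ℝ) hX hY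
  exact (mdifferentiableAt_totalSpace _ _).1 h |>.2

lemma pair_add_left (X X' Y : ∀ x : M, TangentSpace (𝓡 4) x) :
    g.pair (X + X') Y = g.pair X Y + g.pair X' Y := by
  funext x; simp [pair]

lemma pair_smul_left (f : M → ℝ) (X Y : ∀ x : M, TangentSpace (𝓡 4) x) :
    g.pair (f • X) Y = f * g.pair X Y := by
  funext x; simp [pair]

lemma pair_add_right (X Y Y' : ∀ x : M, TangentSpace (𝓡 4) x) :
    g.pair X (Y + Y') = g.pair X Y + g.pair X Y' := by
  funext x; simp [pair]

lemma pair_smul_right (f : M → ℝ) (X Y : ∀ x : M, TangentSpace (𝓡 4) x) :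
    g.pair X (f • Y) = f * g.pair X Y := by
  funext x; simp [pair]

lemma koszul_tensorial_left {Y Z : ∀ x : M, TangentSpace (𝓡 4) x} {x : M}
    (hY : FieldDiffAt Y x) (hZ : FieldDiffAt Z x) :
    TensorialAt (𝓡 4) E4 (fun X ↦ g.koszul Y X Z x) x where
  smul {f X} hf hX := by
    simp only [koszul, pair_smul_left, VectorField.mlieBracket_smul_left hf hX,
      mvfderiv_mul hf (mdiff_pair hX hZ), mvfderiv_mul hf (mdiff_pair hX hY)]
    simp [pair]
    ring
  add {X X'} hX hX' := by
    simp only [koszul, pair_add_left, VectorField.mlieBracket_add_left hX hX',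
      mvfderiv_add (mdiff_pair hX hZ) (mdiff_pair hX' hZ),
      mvfderiv_add (mdiff_pair hX hY) (mdiff_pair hX' hY)]
    simp
    ring

lemma koszul_tensorial_right {Y X : ∀ x : M, TangentSpace (𝓡 4) x} {x : M}
    (hY : FieldDiffAt Y x) (hX : FieldDiffAt X x) :
    TensorialAt (𝓡 4) E4 (fun Z ↦ g.koszul Y X Z x) x where
  smul {f Z} hf hZ := by
    simp only [koszul, pair_smul_right, VectorField.mlieBracket_smul_right hf hZ,
      mvfderiv_mul hf (mdiff_pair hX hZ), mvfderiv_mul hf (mdiff_pair hY hZ)]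
    simp [pair, g.symm x (Z x)]
    ring
  add {Z Z'} hZ hZ' := by
    simp only [koszul, pair_add_right, VectorField.mlieBracket_add_right hZ hZ',
      mvfderiv_add (mdiff_pair hX hZ) (mdiff_pair hX hZ'),
      mvfderiv_add (mdiff_pair hY hZ) (mdiff_pair hY hZ')]
    simp
    ring

lemma koszul_add {Y Y' X Z : ∀ x : M, TangentSpace (𝓡 4) x} {x : M} (hY : FieldDiffAt Y x)
    (hY' : FieldDiffAt Y' x) (hX : FieldDiffAt X x) (hZ : FieldDiffAt Z x) :
    g.koszul (Y + Y') X Z x = g.koszul Y X Z x + g.koszul Y' X Z x := by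
  simp only [koszul, pair_add_left, pair_add_right, VectorField.mlieBracket_add_left hY hY',
    VectorField.mlieBracket_add_right hY hY',
    mvfderiv_add (mdiff_pair hY hZ) (mdiff_pair hY' hZ),
    mvfderiv_add (mdiff_pair hX hY) (mdiff_pair hX hY')]
  simp
  ring

lemma koszul_smul {f : M → ℝ} {Y X Z : ∀ x : M, TangentSpace (𝓡 4) x} {x : M}
    (hf : MDifferentiableAt (𝓡 4) 𝓘(ℝ, ℝ) f x) (hY : FieldDiffAt Y x) (hX : FieldDiffAt X x)
    (hZ : FieldDiffAt Z x) :
    g.koszul (f • Y) X Z x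
      = f x * g.koszul Y X Z x + 2 * (mvfderiv (𝓡 4) f x (X x) * g.val x (Y x) (Z x)) := by
  simp only [koszul, pair_smul_left, pair_smul_right, VectorField.mlieBracket_smul_left hf hY,
    VectorField.mlieBracket_smul_right hf hY,
    mvfderiv_mul hf (mdiff_pair hY hZ), mvfderiv_mul hf (mdiff_pair hX hY)]
  simp [pair, g.symm x (X x) (Y x)]
  ring

lemma fieldDiffAt_extend {x : M} (u : TangentSpace (𝓡 4) x) :
    FieldDiffAt (FiberBundle.extend E4 u) x :=
  FiberBundle.mdifferentiableAt_extend (𝓡 4) E4 u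

/-- The bilinear form `(u, w) ↦ 2 g(∇_u Y, w)` on the tangent space at `x`. -/
def koszulForm (Y : ∀ x : M, TangentSpace (𝓡 4) x) (x : M) (hY : FieldDiffAt Y x) :
    TangentSpace (𝓡 4) x →L[ℝ] TangentSpace (𝓡 4) x →L[ℝ] ℝ :=
  TensorialAt.mkHom₂ (I := 𝓡 4) (F := E4) (F' := E4) (fun X Z ↦ g.koszul Y X Z x) x
    (fun _ hZ ↦ koszul_tensorial_left hY hZ) (fun _ hX ↦ koszul_tensorial_right hY hX)

variable (g)

open Classical in
/-- `∇Y` at `x`, as an endomorphism `u ↦ ∇_u Y` of the tangent space. It is given by the Koszul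
formula where `Y` is differentiable (and by the junk value `0` elsewhere). -/
def nablaFun (Y : ∀ x : M, TangentSpace (𝓡 4) x) (x : M) :
    TangentSpace (𝓡 4) x →L[ℝ] TangentSpace (𝓡 4) x :=
  if hY : FieldDiffAt Y x then
    LinearMap.toContinuousLinearMap ((1 / 2 : ℝ) • (g.sharp x).toLinearMap.comp
      ((ContinuousLinearMap.coeLM ℝ).comp (koszulForm (g := g) Y x hY).toLinearMap))
  else 0

variable {g}

lemma val_nablaFun {Y : ∀ x : M, TangentSpace (𝓡 4) x} {x : M} (hY : FieldDiffAt Y x)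
    (u w : TangentSpace (𝓡 4) x) :
    g.val x (g.nablaFun Y x u) w
      = 1 / 2 * g.koszul Y (FiberBundle.extend E4 u) (FiberBundle.extend E4 w) x := by
  have h : g.nablaFun Y x u
      = (1 / 2 : ℝ) • g.sharp x (koszulForm (g := g) Y x hY u : TangentSpace (𝓡 4) x →ₗ[ℝ] ℝ) := by
    rw [nablaFun, dif_pos hY]; rfl
  rw [h, map_smul, _root_.smul_apply, val_sharp]
  rfl

lemma ext_val {x : M} {u u' : TangentSpace (𝓡 4) x} (h : ∀ w, g.val x u w = g.val x u' w) :
    u = u' := by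
  refine sub_eq_zero.1 (g.nondegenerate x _ fun w ↦ ?_)
  simp [h w]

variable (g)

/-- The Levi-Civita connection of a Lorentzian metric: `g.nabla Y x u` is `∇_u Y` at `x`. -/
def nabla : CovariantDerivative (𝓡 4) E4 (TangentSpace (𝓡 4) : M → Type _) where
  toFun := g.nablaFun
  isCovariantDerivativeOnUniv :=
    { add := by
        intro Y Y' x hY hY' _
        have hs : FieldDiffAt (Y + Y') x := mdifferentiableAt_add_section hY hY'
        ext1 u
        refine ext_val (g := g) fun w ↦ ?_
        rw [_root_.add_apply, map_add, _root_.add_apply, val_nablaFun hs, val_nablaFun hY,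
          val_nablaFun hY', koszul_add hY hY' (fieldDiffAt_extend u) (fieldDiffAt_extend w)]
        ring
      leibniz := by
        intro Y f x hY hf _
        have hs : FieldDiffAt (f • Y) x := hf.smul_section hY
        ext1 u
        refine ext_val (g := g) fun w ↦ ?_
        rw [val_nablaFun hs, koszul_smul hf hY (fieldDiffAt_extend u) (fieldDiffAt_extend w)]
        simp [val_nablaFun hY]
        ring }

lemma val_nabla {X Y Z : ∀ x : M, TangentSpace (𝓡 4) x} {x : M} (hX : FieldDiffAt X x)
    (hY : FieldDiffAt Y x) (hZ : FieldDiffAt Z x) :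
    g.val x (g.nabla Y x (X x)) (Z x) = 1 / 2 * g.koszul Y X Z x := by
  refine (val_nablaFun hY (X x) (Z x)).trans ?_
  congr 1
  exact TensorialAt.mkHom₂_apply (I := 𝓡 4) (F := E4) (F' := E4)
    (Φ := fun X Z ↦ g.koszul Y X Z x)
    (fun _ hZ ↦ koszul_tensorial_left hY hZ) (fun _ hX ↦ koszul_tensorial_right hY hX) hX hZ

/-- The Levi-Civita connection is torsion-free. -/
lemma nabla_torsion_free {X Y : ∀ x : M, TangentSpace (𝓡 4) x} {x : M} (hX : FieldDiffAt X x)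
    (hY : FieldDiffAt Y x) :
    g.nabla Y x (X x) - g.nabla X x (Y x) = VectorField.mlieBracket (𝓡 4) X Y x := by
  refine ext_val (g := g) fun w ↦ ?_
  have hw := fieldDiffAt_extend w
  have h1 := g.val_nabla hX hY hw
  have h2 := g.val_nabla hY hX hw
  simp only [FiberBundle.extend_apply_self] at h1 h2
  rw [map_sub, _root_.sub_apply, h1, h2]
  simp only [koszul, FiberBundle.extend_apply_self, pair_comm Y X,
    VectorField.mlieBracket_swap_apply (V := Y) (W := X)]
  simp
  ring

/-- The Levi-Civita connection is compatible with the metric. -/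
lemma nabla_metric {X Y Z : ∀ x : M, TangentSpace (𝓡 4) x} {x : M} (hX : FieldDiffAt X x)
    (hY : FieldDiffAt Y x) (hZ : FieldDiffAt Z x) :
    mvfderiv (𝓡 4) (g.pair Y Z) x (X x)
      = g.val x (g.nabla Y x (X x)) (Z x) + g.val x (Y x) (g.nabla Z x (X x)) := by
  rw [g.symm x (Y x), g.val_nabla hX hY hZ, g.val_nabla hX hZ hY]
  simp only [koszul, pair_comm Z Y, VectorField.mlieBracket_swap_apply (V := Z) (W := Y)]
  simp
  ring

/-- The curvature operator `R(a, b) c = ∇_a ∇_b c - ∇_b ∇_a c - ∇_[a, b] c`, computed with local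
extensions of the three tangent vectors to vector fields. -/
def curvature (x : M) (a b c : TangentSpace (𝓡 4) x) : TangentSpace (𝓡 4) x :=
  g.nabla (fun y ↦ g.nabla (FiberBundle.extend E4 c) y (FiberBundle.extend E4 b y)) x a
    - g.nabla (fun y ↦ g.nabla (FiberBundle.extend E4 c) y (FiberBundle.extend E4 a y)) x b
    - g.nabla (FiberBundle.extend E4 c) x
        (VectorField.mlieBracket (𝓡 4) (FiberBundle.extend E4 a) (FiberBundle.extend E4 b) x)

/-- The Riemann tensor with all indices down, `R(a, b, c, d) = g(R(c, d) b, a)`. -/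
def riemann (x : M) (a b c d : TangentSpace (𝓡 4) x) : ℝ := g.val x (g.curvature x c d b) a

/-- `ξ` is a Killing vector field: it is smooth and `L_ξ g = 0`, where
`(L_ξ g)(X, Y) = ξ(g(X, Y)) - g([ξ, X], Y) - g(X, [ξ, Y])`. -/
structure IsKilling (ξ : ∀ x : M, TangentSpace (𝓡 4) x) : Prop where
  smooth : ContMDiff (𝓡 4) ((𝓡 4).prod 𝓘(ℝ, E4)) ∞
    (fun x ↦ Bundle.TotalSpace.mk' E4 (E := (TangentSpace (𝓡 4) : M → Type _)) x (ξ x))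
  lie_metric : ∀ (X Y : ∀ x : M, TangentSpace (𝓡 4) x) (x : M),
    FieldDiffAt X x → FieldDiffAt Y x →
      mvfderiv (𝓡 4) (g.pair X Y) x (ξ x)
        - g.val x (VectorField.mlieBracket (𝓡 4) ξ X x) (Y x)
        - g.val x (X x) (VectorField.mlieBracket (𝓡 4) ξ Y x) = 0

end LorentzMetric

section Hypersurface

variable {M : Type*} [TopologicalSpace M] [ChartedSpace E4 M] [IsManifold (𝓡 4) ∞ M]
  {H : Type*} [TopologicalSpace H] [ChartedSpace E3 H] [IsManifold (𝓡 3) ∞ H]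
  (g : LorentzMetric M) (ι : H → M)

/-- The inclusion of tangent spaces `T_p H → T_{ι p} M`. -/
def push (p : H) : TangentSpace (𝓡 3) p →L[ℝ] TangentSpace (𝓡 4) (ι p) :=
  mfderiv (𝓡 3) (𝓡 4) ι p

/-- The covariant derivative `∇_u V` of a vector field `V` of `M` defined along the hypersurface
only, in a direction `u` tangent to the hypersurface. In the local frame `E_i` of `TM` near `ι p`
given by the trivialization, with `V = ∑ V^i E_i`, it is
`∑ dV^i(u) E_i + ∑ V^i ∇_{ι_* u} E_i`. -/
def nablaAlong (V : ∀ p : H, TangentSpace (𝓡 4) (ι p)) (p : H) (u : TangentSpace (𝓡 3) p) :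
    TangentSpace (𝓡 4) (ι p) :=
  (trivializationAt E4 (TangentSpace (𝓡 4) : M → Type _) (ι p)).symm (ι p)
      (mvfderiv (𝓡 3) (fun q ↦ (trivializationAt E4 (TangentSpace (𝓡 4) : M → Type _) (ι p)
        (Bundle.TotalSpace.mk' E4 (ι q) (V q))).2) p u)
    + g.nabla (FiberBundle.extend E4 (V p)) (ι p) (push ι p u)

/-- A null hypersurface: an immersed hypersurface whose induced metric is degenerate, i.e. whose
normal direction is tangent to it. -/
structure IsNullHypersurface : Prop where
  smooth : ContMDiff (𝓡 3) (𝓡 4) ∞ ι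
  immersion : ∀ p : H, Function.Injective (push ι p)
  null : ∀ p : H, ∃ k : TangentSpace (𝓡 3) p, k ≠ 0 ∧
    ∀ w : TangentSpace (𝓡 3) p, g.val (ι p) (push ι p k) (push ι p w) = 0

/-- A Killing horizon of the vector field `ξ`: a null hypersurface to which the Killing field `ξ`
is a (nowhere vanishing) normal. -/
structure IsKillingHorizon (ξ : ∀ x : M, TangentSpace (𝓡 4) x) : Prop where
  hypersurface : IsNullHypersurface g ι
  killing : g.IsKilling ξ
  ne_zero : ∀ p : H, ξ (ι p) ≠ 0
  normal : ∀ (p : H) (w : TangentSpace (𝓡 3) p), g.val (ι p) (ξ (ι p)) (push ι p w) = 0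

/-- A geodesic foliation (`Ω = 1`) of a null hypersurface: the geodesic null generator field
`L = L_geod`, its affine parameter `v`, whose level sets are the leaves `S_v`, and the
conjugate null normal `Lbar` of the leaves. -/
structure GeodesicFoliation where
  /-- The null generator field `L = L_geod`. -/
  L : ∀ p : H, TangentSpace (𝓡 3) p
  L_smooth : ContMDiff (𝓡 3) ((𝓡 3).prod 𝓘(ℝ, E3)) ∞
    (fun p ↦ Bundle.TotalSpace.mk' E3 (E := (TangentSpace (𝓡 3) : H → Type _)) p (L p))
  L_normal : ∀ (p : H) (w : TangentSpace (𝓡 3) p), g.val (ι p) (push ι p (L p)) (push ι p w) = 0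
  geodesic : ∀ p : H, nablaAlong g ι (fun q ↦ push ι q (L q)) p (L p) = 0
  /-- The affine parameter; the initial section `S₀` is its zero set. -/
  v : H → ℝ
  v_smooth : ContMDiff (𝓡 3) 𝓘(ℝ, ℝ) ∞ v
  L_v : ∀ p : H, mvfderiv (𝓡 3) v p (L p) = 1
  /-- Every null generator meets the initial section. -/
  generator : ∀ p : H, ∃ (γ : ℝ → H) (t : ℝ),
    IsMIntegralCurveOn γ L (Set.uIcc 0 t) ∧ γ 0 = p ∧ v (γ t) = 0
  /-- The conjugate null normal of the leaves. -/
  Lbar : ∀ p : H, TangentSpace (𝓡 4) (ι p)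
  Lbar_smooth : ContMDiff (𝓡 3) ((𝓡 4).prod 𝓘(ℝ, E4)) ∞
    (fun p ↦ Bundle.TotalSpace.mk' E4 (E := (TangentSpace (𝓡 4) : M → Type _)) (ι p) (Lbar p))
  Lbar_null : ∀ p : H, g.val (ι p) (Lbar p) (Lbar p) = 0
  Lbar_normal : ∀ (p : H) (w : TangentSpace (𝓡 3) p), mvfderiv (𝓡 3) v p w = 0 →
    g.val (ι p) (Lbar p) (push ι p w) = 0
  normalized : ∀ p : H, g.val (ι p) (push ι p (L p)) (Lbar p) = -1

namespace GeodesicFoliation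

variable {g ι} (S : GeodesicFoliation g ι)

/-- `w` is tangent to the leaf through `p`. -/
def Tangent (p : H) (w : TangentSpace (𝓡 3) p) : Prop := mvfderiv (𝓡 3) S.v p w = 0

/-- `L` as a vector field of `M` along the hypersurface. -/
def LM (p : H) : TangentSpace (𝓡 4) (ι p) := push ι p (S.L p)

/-- The projection `T_{ι p} M → T_p S_v` along the span of `L` and `Lbar`: the vector
`Z + g(Z, Lbar) L + g(Z, L) Lbar`, read in `T_p H` through the injection `push ι p`. -/
def proj (p : H) (Z : TangentSpace (𝓡 4) (ι p)) : TangentSpace (𝓡 3) p :=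
  Function.invFun (push ι p)
    (Z + g.val (ι p) Z (S.Lbar p) • S.LM p + g.val (ι p) Z (S.LM p) • S.Lbar p)

/-! The `S`-tensors below are defined on all of `T_{ι p} M`, being zero on `L` and `Lbar`. -/

/-- The induced metric of the leaves. -/
def gslash (p : H) (Z W : TangentSpace (𝓡 4) (ι p)) : ℝ :=
  g.val (ι p) (push ι p (S.proj p Z)) (push ι p (S.proj p W))

/-- The null second fundamental form `χ(X, Y) = g(∇_X L, Y)`. -/
def chi (p : H) (Z W : TangentSpace (𝓡 4) (ι p)) : ℝ :=
  g.val (ι p) (nablaAlong g ι S.LM p (S.proj p Z)) (push ι p (S.proj p W))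

/-- The conjugate null second fundamental form `g(∇_X Lbar, Y)`. -/
def chibar (p : H) (Z W : TangentSpace (𝓡 4) (ι p)) : ℝ :=
  g.val (ι p) (nablaAlong g ι S.Lbar p (S.proj p Z)) (push ι p (S.proj p W))

/-- The torsion `ζ(X) = g(∇_X L, Lbar)`. -/
def zeta (p : H) (Z : TangentSpace (𝓡 4) (ι p)) : ℝ :=
  g.val (ι p) (nablaAlong g ι S.LM p (S.proj p Z)) (S.Lbar p)

/-- The curvature component `β(X) = R(X, L, Lbar, L)`. -/
def beta (p : H) (Z : TangentSpace (𝓡 4) (ι p)) : ℝ :=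
  g.riemann (ι p) (push ι p (S.proj p Z)) (S.LM p) (S.Lbar p) (S.LM p)

/-- The Lie derivative along `L` of an `S` 1-form:
`(L_L T)(u) = L(T(U)) - T([L, U])` for any local extension `U` of `u` to a vector field on the
hypersurface. -/
def lie1 (T : ∀ p : H, TangentSpace (𝓡 4) (ι p) → ℝ) (p : H) (u : TangentSpace (𝓡 3) p) : ℝ :=
  mvfderiv (𝓡 3) (fun q ↦ T q (push ι q (FiberBundle.extend E3 u q))) p (S.L p)
    - T p (push ι p (VectorField.mlieBracket (𝓡 3) S.L (FiberBundle.extend E3 u) p))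

/-- The covariant derivative along `L` of an `S` 1-form:
`(∇_L T)(u) = L(T(U)) - T(∇_L U)`. -/
def nabla1 (T : ∀ p : H, TangentSpace (𝓡 4) (ι p) → ℝ) (p : H) (u : TangentSpace (𝓡 3) p) : ℝ :=
  mvfderiv (𝓡 3) (fun q ↦ T q (push ι q (FiberBundle.extend E3 u q))) p (S.L p)
    - T p (nablaAlong g ι (fun q ↦ push ι q (FiberBundle.extend E3 u q)) p (S.L p))

/-- The Lie derivative along `L` of a covariant `S` 2-tensor. -/
def lie2 (T : ∀ p : H, TangentSpace (𝓡 4) (ι p) → TangentSpace (𝓡 4) (ι p) → ℝ) (p : H)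
    (u w : TangentSpace (𝓡 3) p) : ℝ :=
  mvfderiv (𝓡 3) (fun q ↦ T q (push ι q (FiberBundle.extend E3 u q))
      (push ι q (FiberBundle.extend E3 w q))) p (S.L p)
    - T p (push ι p (VectorField.mlieBracket (𝓡 3) S.L (FiberBundle.extend E3 u) p)) (push ι p w)
    - T p (push ι p u) (push ι p (VectorField.mlieBracket (𝓡 3) S.L (FiberBundle.extend E3 w) p))

/-- The covariant derivative along `L` of a covariant `S` 2-tensor. -/
def nabla2 (T : ∀ p : H, TangentSpace (𝓡 4) (ι p) → TangentSpace (𝓡 4) (ι p) → ℝ) (p : H)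
    (u w : TangentSpace (𝓡 3) p) : ℝ :=
  mvfderiv (𝓡 3) (fun q ↦ T q (push ι q (FiberBundle.extend E3 u q))
      (push ι q (FiberBundle.extend E3 w q))) p (S.L p)
    - T p (nablaAlong g ι (fun q ↦ push ι q (FiberBundle.extend E3 u q)) p (S.L p)) (push ι p w)
    - T p (push ι p u) (nablaAlong g ι (fun q ↦ push ι q (FiberBundle.extend E3 w q)) p (S.L p))

end GeodesicFoliation

end Hypersurface

end

/-! Since `ξ` and `L` are both normal to the horizon, `ξ = f L` there, with `f = -g(ξ, Lbar)` smooth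
and nowhere zero (`factor`). This identity may be differentiated in directions tangent to the
horizon: `∇_u ξ = df(u) L + f ∇_u L`. The Killing equation makes `g(∇_u ξ, w)` skew in `u, w`, while
`g(∇_u L, w)` is symmetric because `L` is normal and the connection has no torsion. So `g(∇_u L, w)
= 0`, and `∇_u L = -ω(u) L` with `ω(u) = g(∇_u L, Lbar)` (`connForm`). This gives claim 1. Claim 2
follows because `∇_L U` and `[L, U]` differ only by a multiple of `L`; the same fact makes the
projected Lie and covariant derivatives along `L` agree on forms extended by zero.

Now `∇_u ξ = (df(u) - f ω(u)) L`, and `ω(L) = 0` gives `κ = L f`. The second ingredient is the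
Killing identity `g(∇²_{a,b} ξ, c) = -R(a, ξ, b, c)` (`IsKilling.val_hess`). Differentiating `∇_ξ ξ
= κ ξ` along the horizon leaves `∇²_{u,ξ} ξ = dκ(u) ξ`, whose product with `Lbar` is claim 3.
Differentiating the formula for `∇_U ξ` along `L`, where the Hessian vanishes because `R(L, L, ·, ·)
= 0`, gives `f (ℒ_L ω)(U) = dκ(U)`, which is claim 4.

If `κ = c` is constant and `L = ξ` on the initial section, then `f = 1 + c v`, so `df` vanishes on
the leaves. Differentiating `∇_W ξ = -f ω(W) L` along a second leaf direction `U` produces `R(L, U)`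
applied to `Lbar`, together with a term `c χbar(U, W)` that comes from the `L`-component of `∇_U W`.
Commuting `∇_L` with `∇_U` on `Lbar` produces the same curvature; all terms in `ω` cancel, and claim
5 remains (`mvfderiv_val_nablaAlong_Lbar`).

Because `L` and `Lbar` live only on the horizon, these arguments need a calculus for vector fields
along `ι`: metric compatibility, vanishing torsion and the curvature commutator for `nablaAlong`. -/

noncomputable section

/-! ### Lie brackets as commutators of derivations -/

section Bracket

open VectorField

lemma mvfderiv_comp_mfderiv {E E' : Type*} [NormedAddCommGroup E] [NormedSpace ℝ E]
    [NormedAddCommGroup E'] [NormedSpace ℝ E'] {B B' : Type*} [TopologicalSpace B]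
    [TopologicalSpace B'] {I : ModelWithCorners ℝ E B} {I' : ModelWithCorners ℝ E' B'}
    {N N' : Type*} [TopologicalSpace N] [ChartedSpace B N] [TopologicalSpace N']
    [ChartedSpace B' N'] {F : Type*} [NormedAddCommGroup F] [NormedSpace ℝ F]
    {h : N' → F} {φ : N → N'} {q : N} (hh : MDifferentiableAt I' 𝓘(ℝ, F) h (φ q))
    (hφ : MDifferentiableAt I I' φ q) (w : TangentSpace I q) :
    mvfderiv I (h ∘ φ) q w = mvfderiv I' h (φ q) (mfderiv I I' φ q w) :=
  mfderiv_comp_apply q hh hφ w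

lemma mvfderiv_congr {E : Type*} [NormedAddCommGroup E] [NormedSpace ℝ E]
    {B : Type*} [TopologicalSpace B] {I : ModelWithCorners ℝ E B}
    {N : Type*} [TopologicalSpace N] [ChartedSpace B N]
    {F : Type*} [NormedAddCommGroup F] [NormedSpace ℝ F]
    {h k : N → F} {q : N} (hk : h =ᶠ[𝓝 q] k) (w : TangentSpace I q) :
    mvfderiv I h q w = mvfderiv I k q w :=
  congrArg (fun A : TangentSpace I q →L[ℝ] F ↦ A w) (hk.mfderiv_eq (I := I) (I' := 𝓘(ℝ, F)))

variable {E : Type*} [NormedAddCommGroup E] [NormedSpace ℝ E] [CompleteSpace E]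
  {N : Type*} [TopologicalSpace N] [ChartedSpace E N]
  [IsManifold 𝓘(ℝ, E) ∞ N] {F : Type*} [NormedAddCommGroup F] [NormedSpace ℝ F]

-- The chain rule, with the invertibility of the derivative of the inverse chart: it moves the
-- derivation `X` to the model space, where the commutator formula is known.
omit [CompleteSpace E] in
lemma fderiv_comp_extChartAt_symm {h : N → F} {p : N} {z : E}
    (hz : z ∈ (extChartAt 𝓘(ℝ, E) p).target)
    (hh : MDifferentiableAt 𝓘(ℝ, E) 𝓘(ℝ, F) h ((extChartAt 𝓘(ℝ, E) p).symm z))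
    (X : ∀ q : N, TangentSpace 𝓘(ℝ, E) q) :
    fderiv ℝ (h ∘ (extChartAt 𝓘(ℝ, E) p).symm) z
      (mpullbackWithin 𝓘(ℝ, E) 𝓘(ℝ, E) (extChartAt 𝓘(ℝ, E) p).symm X (Set.range 𝓘(ℝ, E)) z)
      = mvfderiv 𝓘(ℝ, E) h ((extChartAt 𝓘(ℝ, E) p).symm z)
        (X ((extChartAt 𝓘(ℝ, E) p).symm z)) := by
  have hI : IsManifold 𝓘(ℝ, E) 1 N := inferInstance
  have hr : Set.range 𝓘(ℝ, E) = Set.univ := by simp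
  have hd : MDifferentiableAt 𝓘(ℝ, E) 𝓘(ℝ, E) (extChartAt 𝓘(ℝ, E) p).symm z := by
    have := mdifferentiableWithinAt_extChartAt_symm hz
    rwa [hr, mdifferentiableWithinAt_univ] at this
  have hc := mvfderiv_comp_mfderiv (q := z) hh hd
    (mpullbackWithin 𝓘(ℝ, E) 𝓘(ℝ, E) (extChartAt 𝓘(ℝ, E) p).symm X (Set.range 𝓘(ℝ, E)) z)
  have hi := isInvertible_mfderivWithin_extChartAt_symm hz
  have e : mfderiv 𝓘(ℝ, E) 𝓘(ℝ, E) (extChartAt 𝓘(ℝ, E) p).symm z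
      (mpullbackWithin 𝓘(ℝ, E) 𝓘(ℝ, E) (extChartAt 𝓘(ℝ, E) p).symm X (Set.range 𝓘(ℝ, E)) z)
      = X ((extChartAt 𝓘(ℝ, E) p).symm z) := by
    rw [mpullbackWithin_apply]
    have := hi.self_apply_inverse (X ((extChartAt 𝓘(ℝ, E) p).symm z))
    rw [hr, mfderivWithin_univ] at this
    rw [hr, mfderivWithin_univ]
    exact this
  rw [e] at hc
  rw [← hc, mvfderiv, mfderiv_eq_fderiv]
  rfl

/-- The Lie bracket acts on functions as a commutator of derivations. -/
lemma mvfderiv_mlieBracket {h : N → F} {p : N} {X Y : ∀ q : N, TangentSpace 𝓘(ℝ, E) q}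
    (hh : ContMDiffAt 𝓘(ℝ, E) 𝓘(ℝ, F) 2 h p)
    (hX : MDifferentiableAt 𝓘(ℝ, E) ((𝓘(ℝ, E)).prod 𝓘(ℝ, E))
      (fun q ↦ Bundle.TotalSpace.mk' E (E := (TangentSpace 𝓘(ℝ, E) : N → Type _)) q (X q)) p)
    (hY : MDifferentiableAt 𝓘(ℝ, E) ((𝓘(ℝ, E)).prod 𝓘(ℝ, E))
      (fun q ↦ Bundle.TotalSpace.mk' E (E := (TangentSpace 𝓘(ℝ, E) : N → Type _)) q (Y q)) p)
    (hhX : MDifferentiableAt 𝓘(ℝ, E) 𝓘(ℝ, F) (fun q ↦ mvfderiv 𝓘(ℝ, E) h q (X q)) p)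
    (hhY : MDifferentiableAt 𝓘(ℝ, E) 𝓘(ℝ, F) (fun q ↦ mvfderiv 𝓘(ℝ, E) h q (Y q)) p) :
    mvfderiv 𝓘(ℝ, E) h p (mlieBracket 𝓘(ℝ, E) X Y p)
      = mvfderiv 𝓘(ℝ, E) (fun q ↦ mvfderiv 𝓘(ℝ, E) h q (Y q)) p (X p)
        - mvfderiv 𝓘(ℝ, E) (fun q ↦ mvfderiv 𝓘(ℝ, E) h q (X q)) p (Y p) := by
  have hI : IsManifold 𝓘(ℝ, E) 1 N := inferInstance
  have hI2 : IsManifold 𝓘(ℝ, E) 2 N := inferInstance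
  have hr : Set.range 𝓘(ℝ, E) = Set.univ := by simp
  have hs : (extChartAt 𝓘(ℝ, E) p).symm (extChartAt 𝓘(ℝ, E) p p) = p := extChartAt_to_inv p
  have hp : extChartAt 𝓘(ℝ, E) p p ∈ (extChartAt 𝓘(ℝ, E) p).target := mem_extChartAt_target p
  have hd1 : MDifferentiableAt 𝓘(ℝ, E) 𝓘(ℝ, F) h p := ContMDiffAt.mdifferentiableAt hh (by decide)
  set φ := extChartAt 𝓘(ℝ, E) p with hφ
  set X' := mpullbackWithin 𝓘(ℝ, E) 𝓘(ℝ, E) φ.symm X (Set.range 𝓘(ℝ, E)) with hX'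
  set Y' := mpullbackWithin 𝓘(ℝ, E) 𝓘(ℝ, E) φ.symm Y (Set.range 𝓘(ℝ, E)) with hY'
  have dX : DifferentiableAt ℝ X' (φ p) := by
    have := MDifferentiableWithinAt.differentiableWithinAt_mpullbackWithin_vectorField
      (mdifferentiableWithinAt_univ.2 hX)
    rw [Set.preimage_univ, Set.univ_inter, ← hφ, ← hX', hr] at this
    exact differentiableWithinAt_univ.1 this
  have dY : DifferentiableAt ℝ Y' (φ p) := by
    have := MDifferentiableWithinAt.differentiableWithinAt_mpullbackWithin_vectorField
      (mdifferentiableWithinAt_univ.2 hY)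
    rw [Set.preimage_univ, Set.univ_inter, ← hφ, ← hY', hr] at this
    exact differentiableWithinAt_univ.1 this
  have ch : ContDiffAt ℝ 2 (h ∘ φ.symm) (φ p) := by
    have := (contMDiffAt_iff.1 hh).2
    rw [hr, contDiffWithinAt_univ] at this
    exact this
  -- The identity in the model space rests on the symmetry of the second derivative, which is why
  -- `h` must be twice differentiable.
  have key := fderiv_apply_lieBracket ch (by simp) dY dX
  have ht : ∀ᶠ z in 𝓝 (φ p), z ∈ φ.target := extChartAt_target_mem_nhds p
  have hd : ∀ᶠ z in 𝓝 (φ p), MDifferentiableAt 𝓘(ℝ, E) 𝓘(ℝ, F) h (φ.symm z) := by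
    have h1 : ∀ᶠ q in 𝓝 p, MDifferentiableAt 𝓘(ℝ, E) 𝓘(ℝ, F) h q := by
      filter_upwards [(contMDiffAt_iff_contMDiffAt_nhds (by decide)).1 hh] with q hq
      exact ContMDiffAt.mdifferentiableAt hq (n := 2) (by decide)
    have h2 := continuousAt_extChartAt_symm (I := 𝓘(ℝ, E)) p
    rw [ContinuousAt, extChartAt_to_inv] at h2
    exact h2.eventually h1
  have eX : (fun z ↦ fderiv ℝ (h ∘ φ.symm) z (X' z)) =ᶠ[𝓝 (φ p)]
      (fun q ↦ mvfderiv 𝓘(ℝ, E) h q (X q)) ∘ φ.symm := by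
    filter_upwards [ht, hd] with z hz hdz using fderiv_comp_extChartAt_symm hz hdz X
  have eY : (fun z ↦ fderiv ℝ (h ∘ φ.symm) z (Y' z)) =ᶠ[𝓝 (φ p)]
      (fun q ↦ mvfderiv 𝓘(ℝ, E) h q (Y q)) ∘ φ.symm := by
    filter_upwards [ht, hd] with z hz hdz using fderiv_comp_extChartAt_symm hz hdz Y
  rw [eX.fderiv_eq, eY.fderiv_eq] at key
  -- At the centre of its own chart, the derivative of the chart is the identity, so a pulled-back
  -- field keeps its value.
  have eval : ∀ Z : ∀ q : N, TangentSpace 𝓘(ℝ, E) q,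
      mpullbackWithin 𝓘(ℝ, E) 𝓘(ℝ, E) φ.symm Z (Set.range 𝓘(ℝ, E)) (φ p) = (Z p : E) := by
    intro Z
    have h1 : ∀ q, q = p → (Z q : E) = Z p := by rintro _ rfl; rfl
    rw [← h1 _ hs]
    have h2 := mfderivWithin_range_extChartAt_symm (I := 𝓘(ℝ, E)) (x := p)
    rw [mpullbackWithin_apply, h2]
    exact congrArg (fun A : E →L[ℝ] E ↦ A _) ContinuousLinearMap.inverse_id
  have der : ∀ {k : N → F} (w : TangentSpace 𝓘(ℝ, E) p), MDifferentiableAt 𝓘(ℝ, E) 𝓘(ℝ, F) k p →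
      mvfderiv 𝓘(ℝ, E) k p w = fderiv ℝ (k ∘ φ.symm) (φ p) (w : E) := by
    intro k w hk
    have := hk.mvfderiv
    rw [hr, fderivWithin_univ] at this
    rw [this]
    rfl
  have eB : mlieBracket 𝓘(ℝ, E) X Y p = lieBracket ℝ X' Y' (φ p) := by
    have h2 := mfderiv_extChartAt_self (I := 𝓘(ℝ, E)) (x := p)
    rw [← mlieBracketWithin_univ, mlieBracketWithin_apply, h2, Set.preimage_univ, Set.univ_inter,
      hr]
    refine (congrArg (fun A : E →L[ℝ] E ↦ A _) ContinuousLinearMap.inverse_id).trans ?_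
    rw [hX', hY', hr]
    exact congrFun lieBracketWithin_univ _
  have e1 : X' (φ p) = X p := eval X
  have e2 : Y' (φ p) = Y p := eval Y
  rw [e1, e2] at key
  rw [der _ hd1, der _ hhX, der _ hhY, eB]
  exact key

end Bracket

/-! ### Smoothness of differentials applied to vector fields -/

section
variable {E E' : Type*} [NormedAddCommGroup E] [NormedSpace ℝ E]
  [NormedAddCommGroup E'] [NormedSpace ℝ E']
  {N N' : Type*} [TopologicalSpace N] [ChartedSpace E N] [TopologicalSpace N']
  [ChartedSpace E' N'] [IsManifold 𝓘(ℝ, E) ∞ N] [IsManifold 𝓘(ℝ, E') ∞ N']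

lemma contMDiffAt_mfderiv_apply {φ : N → N'} {p : N} {X : ∀ q : N, TangentSpace 𝓘(ℝ, E) q}
    (hφ : ContMDiffAt 𝓘(ℝ, E) 𝓘(ℝ, E') ∞ φ p)
    (hX : ContMDiffAt 𝓘(ℝ, E) ((𝓘(ℝ, E)).prod 𝓘(ℝ, E)) ∞
      (fun q ↦ Bundle.TotalSpace.mk' E (E := (TangentSpace 𝓘(ℝ, E) : N → Type _)) q (X q)) p) :
    ContMDiffAt 𝓘(ℝ, E) ((𝓘(ℝ, E')).prod 𝓘(ℝ, E')) ∞
      (fun q ↦ Bundle.TotalSpace.mk' E' (E := (TangentSpace 𝓘(ℝ, E') : N' → Type _)) (φ q)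
        (mfderiv 𝓘(ℝ, E) 𝓘(ℝ, E') φ q (X q))) p := by
  have h := hφ.mfderiv_const (m := ∞) le_rfl
  exact ContMDiffAt.clm_apply_of_inCoordinates (E₁ := (TangentSpace 𝓘(ℝ, E) : N → Type _))
    (E₂ := (TangentSpace 𝓘(ℝ, E') : N' → Type _)) (b₁ := fun q ↦ q) h hX hφ

lemma contMDiffAt_mvfderiv_apply {F : Type*} [NormedAddCommGroup F] [NormedSpace ℝ F]
    {h : N → F} {p : N} {X : ∀ q : N, TangentSpace 𝓘(ℝ, E) q}
    (hh : ContMDiffAt 𝓘(ℝ, E) 𝓘(ℝ, F) ∞ h p)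
    (hX : ContMDiffAt 𝓘(ℝ, E) ((𝓘(ℝ, E)).prod 𝓘(ℝ, E)) ∞
      (fun q ↦ Bundle.TotalSpace.mk' E (E := (TangentSpace 𝓘(ℝ, E) : N → Type _)) q (X q)) p) :
    ContMDiffAt 𝓘(ℝ, E) 𝓘(ℝ, F) ∞ (fun q ↦ mvfderiv 𝓘(ℝ, E) h q (X q)) p := by
  exact (contMDiff_snd_tangentBundle_modelSpace F 𝓘(ℝ, F)).contMDiffAt.comp p
    (contMDiffAt_mfderiv_apply hh hX)

end

/-! ### Coordinates of the tangent bundle and vector fields along a map -/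

section
variable {M : Type*} [TopologicalSpace M] [ChartedSpace E4 M] [IsManifold (𝓡 4) ∞ M]
  {N : Type*} [TopologicalSpace N]

/-- Smoothness at `q` of a vector field along a map `φ`. -/
abbrev SmoothAlongAt (n : ℕ) [ChartedSpace (EuclideanSpace ℝ (Fin n)) N] (φ : N → M)
    (V : ∀ q : N, TangentSpace (𝓡 4) (φ q)) (q : N) : Prop :=
  ContMDiffAt (𝓡 n) ((𝓡 4).prod 𝓘(ℝ, E4)) ∞
    (fun q ↦ Bundle.TotalSpace.mk' E4 (E := (TangentSpace (𝓡 4) : M → Type _)) (φ q) (V q)) q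

/-- Differentiability at `q` of a vector field along a map `φ`. -/
abbrev DiffAlongAt (n : ℕ) [ChartedSpace (EuclideanSpace ℝ (Fin n)) N] (φ : N → M)
    (V : ∀ q : N, TangentSpace (𝓡 4) (φ q)) (q : N) : Prop :=
  MDifferentiableAt (𝓡 n) ((𝓡 4).prod 𝓘(ℝ, E4))
    (fun q ↦ Bundle.TotalSpace.mk' E4 (E := (TangentSpace (𝓡 4) : M → Type _)) (φ q) (V q)) q

/-- Smoothness at `x` of a vector field. -/
abbrev FieldSmoothAt (X : ∀ x : M, TangentSpace (𝓡 4) x) (x : M) : Prop :=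
  ContMDiffAt (𝓡 4) ((𝓡 4).prod 𝓘(ℝ, E4)) ∞
    (fun y ↦ Bundle.TotalSpace.mk' E4 (E := (TangentSpace (𝓡 4) : M → Type _)) y (X y)) x

/-- The coordinates of a tangent vector at `x` in the trivialization around `x₀`. -/
def tcoord (x₀ : M) {x : M} (v : TangentSpace (𝓡 4) x) : E4 :=
  (trivializationAt E4 (TangentSpace (𝓡 4) : M → Type _) x₀ (Bundle.TotalSpace.mk' E4 x v)).2

/-- The local vector field around `x₀` with constant coordinates `c`. -/
def constField (x₀ : M) (c : E4) (x : M) : TangentSpace (𝓡 4) x :=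
  (trivializationAt E4 (TangentSpace (𝓡 4) : M → Type _) x₀).symm x c

/-- Identifies the extensions in the definitions of curvature and of `nablaAlong` as fields with
constant coordinates; near the base point they therefore depend linearly on the vector. -/
lemma extend_eq_constField {x₀ : M} (v : TangentSpace (𝓡 4) x₀) :
    FiberBundle.extend E4 v = constField x₀ (tcoord x₀ v) := rfl

lemma constField_tcoord {x₀ x : M}
    (hx : x ∈ (trivializationAt E4 (TangentSpace (𝓡 4) : M → Type _) x₀).baseSet)
    (v : TangentSpace (𝓡 4) x) : constField x₀ (tcoord x₀ v) x = v :=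
  Bundle.Trivialization.symm_apply_apply_mk _ hx v

lemma tcoord_constField {x₀ x : M}
    (hx : x ∈ (trivializationAt E4 (TangentSpace (𝓡 4) : M → Type _) x₀).baseSet)
    (c : E4) : tcoord x₀ (constField x₀ c x) = c :=
  congrArg Prod.snd (Bundle.Trivialization.apply_mk_symm _ hx c)

lemma mem_baseSet_self (x₀ : M) :
    x₀ ∈ (trivializationAt E4 (TangentSpace (𝓡 4) : M → Type _) x₀).baseSet :=
  FiberBundle.mem_baseSet_trivializationAt' x₀

lemma eventually_mem_baseSet (x₀ : M) :
    ∀ᶠ x in 𝓝 x₀, x ∈ (trivializationAt E4 (TangentSpace (𝓡 4) : M → Type _) x₀).baseSet :=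
  (trivializationAt E4 (TangentSpace (𝓡 4) : M → Type _) x₀).open_baseSet.mem_nhds
    (mem_baseSet_self x₀)

lemma smoothAt_constField (x₀ : M) (c : E4) : FieldSmoothAt (constField x₀ c) x₀ := by
  have := FiberBundle.contMDiffAt_extend (𝓡 4) E4 (k := ∞) (V := (TangentSpace (𝓡 4) : M → Type _))
    (constField x₀ c x₀)
  rw [extend_eq_constField, tcoord_constField (mem_baseSet_self x₀)] at this
  exact this

lemma constField_eq_symmL {x₀ x : M}
    (hx : x ∈ (trivializationAt E4 (TangentSpace (𝓡 4) : M → Type _) x₀).baseSet)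
    (c : E4) : constField x₀ c x
      = (trivializationAt E4 (TangentSpace (𝓡 4) : M → Type _) x₀).symmL ℝ x c :=
  (Bundle.Trivialization.symmL_apply _ hx c).symm

lemma constField_add {x₀ x : M}
    (hx : x ∈ (trivializationAt E4 (TangentSpace (𝓡 4) : M → Type _) x₀).baseSet)
    (c d : E4) : constField x₀ (c + d) x = constField x₀ c x + constField x₀ d x := by
  simp only [constField_eq_symmL hx, map_add]

lemma constField_smul {x₀ x : M}
    (hx : x ∈ (trivializationAt E4 (TangentSpace (𝓡 4) : M → Type _) x₀).baseSet)
    (r : ℝ) (c : E4) : constField x₀ (r • c) x = r • constField x₀ c x := by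
  simp only [constField_eq_symmL hx, map_smul]

lemma constField_eq_sum {x₀ x : M}
    (hx : x ∈ (trivializationAt E4 (TangentSpace (𝓡 4) : M → Type _) x₀).baseSet)
    (c : E4) : constField x₀ c x = ∑ i, c i • constField x₀ (EuclideanSpace.single i 1) x := by
  have h : c = ∑ i, c i • (EuclideanSpace.single i (1 : ℝ) : E4) := by
    simpa using ((EuclideanSpace.basisFun (Fin 4) ℝ).sum_repr c).symm
  conv_lhs => rw [h]
  simp only [constField_eq_symmL hx, map_sum, map_smul]

lemma tcoord_add {x₀ x : M}
    (hx : x ∈ (trivializationAt E4 (TangentSpace (𝓡 4) : M → Type _) x₀).baseSet)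
    (v w : TangentSpace (𝓡 4) x) : tcoord x₀ (v + w) = tcoord x₀ v + tcoord x₀ w := by
  rw [← tcoord_constField hx (tcoord x₀ v + tcoord x₀ w), constField_add hx,
    constField_tcoord hx, constField_tcoord hx]

lemma tcoord_smul {x₀ x : M}
    (hx : x ∈ (trivializationAt E4 (TangentSpace (𝓡 4) : M → Type _) x₀).baseSet)
    (r : ℝ) (v : TangentSpace (𝓡 4) x) : tcoord x₀ (r • v) = r • tcoord x₀ v := by
  rw [← tcoord_constField hx (r • tcoord x₀ v), constField_smul hx, constField_tcoord hx]

lemma smoothAlongAt_iff {n : ℕ} [ChartedSpace (EuclideanSpace ℝ (Fin n)) N] {φ : N → M}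
    {V : ∀ q : N, TangentSpace (𝓡 4) (φ q)} {q : N} :
    SmoothAlongAt n φ V q ↔ ContMDiffAt (𝓡 n) (𝓡 4) ∞ φ q ∧
      ContMDiffAt (𝓡 n) 𝓘(ℝ, E4) ∞ (fun q' ↦ tcoord (φ q) (V q')) q :=
  Bundle.contMDiffAt_totalSpace

lemma diffAlongAt_iff {n : ℕ} [ChartedSpace (EuclideanSpace ℝ (Fin n)) N] {φ : N → M}
    {V : ∀ q : N, TangentSpace (𝓡 4) (φ q)} {q : N} :
    DiffAlongAt n φ V q ↔ MDifferentiableAt (𝓡 n) (𝓡 4) φ q ∧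
      MDifferentiableAt (𝓡 n) 𝓘(ℝ, E4) (fun q' ↦ tcoord (φ q) (V q')) q :=
  mdifferentiableAt_totalSpace _ _

variable {n : ℕ} [ChartedSpace (EuclideanSpace ℝ (Fin n)) N]

namespace LorentzMetric

variable (g : LorentzMetric M)

omit [ChartedSpace (EuclideanSpace ℝ (Fin n)) N] in
lemma smoothAlongAt_pair [ChartedSpace (EuclideanSpace ℝ (Fin n)) N] {φ : N → M}
    {V W : ∀ q : N, TangentSpace (𝓡 4) (φ q)} {q : N}
    (hV : SmoothAlongAt n φ V q) (hW : SmoothAlongAt n φ W q) :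
    ContMDiffAt (𝓡 n) 𝓘(ℝ, ℝ) ∞ (fun q ↦ g.val (φ q) (V q) (W q)) q := by
  have h := ((g.contMDiff.contMDiffAt).comp q (smoothAlongAt_iff.1 hV).1).clm_bundle_apply₂
    (F₁ := E4) (F₂ := E4) (F₃ := ℝ) (E₁ := (TangentSpace (𝓡 4) : M → Type _))
    (E₂ := (TangentSpace (𝓡 4) : M → Type _)) (E₃ := Bundle.Trivial M ℝ) hV hW
  exact (Bundle.contMDiffAt_totalSpace.1 h).2

lemma diffAlongAt_pair {φ : N → M}
    {V W : ∀ q : N, TangentSpace (𝓡 4) (φ q)} {q : N}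
    (hV : DiffAlongAt n φ V q) (hW : DiffAlongAt n φ W q) :
    MDifferentiableAt (𝓡 n) 𝓘(ℝ, ℝ) (fun q ↦ g.val (φ q) (V q) (W q)) q := by
  have h := ((g.contMDiff.mdifferentiable (by simp) (φ q)).comp q
    (diffAlongAt_iff.1 hV).1).clm_bundle_apply₂
    (F₁ := E4) (F₂ := E4) (F₃ := ℝ) (E₁ := (TangentSpace (𝓡 4) : M → Type _))
    (E₂ := (TangentSpace (𝓡 4) : M → Type _)) (E₃ := Bundle.Trivial M ℝ) hV hW
  exact ((mdifferentiableAt_totalSpace _ _).1 h).2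

/-- A vector field along a map is smooth as soon as its products with a local frame are. -/
lemma smoothAlongAt_of_pair {φ : N → M} {V : ∀ q : N, TangentSpace (𝓡 4) (φ q)} {q : N}
    (hφ : ContMDiffAt (𝓡 n) (𝓡 4) ∞ φ q)
    (h : ∀ c : E4, ContMDiffAt (𝓡 n) 𝓘(ℝ, ℝ) ∞
      (fun q' ↦ g.val (φ q') (V q') (constField (φ q) c (φ q'))) q) :
    SmoothAlongAt n φ V q := by
  rw [smoothAlongAt_iff]
  refine ⟨hφ, ?_⟩
  set x₀ := φ q with hx₀
  let E : Fin 4 → E4 := fun i ↦ EuclideanSpace.single i 1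
  -- The Gram matrix of the local frame, as a linear map from coordinates to products with the frame
  -- fields.
  let G : N → E4 →L[ℝ] (Fin 4 → ℝ) := fun q' ↦ ∑ i, ∑ j,
    g.val (φ q') (constField x₀ (E i) (φ q')) (constField x₀ (E j) (φ q')) •
      (ContinuousLinearMap.single ℝ (fun _ : Fin 4 ↦ ℝ) j).comp
        (EuclideanSpace.proj i : E4 →L[ℝ] ℝ)
  have hE : ∀ c, SmoothAlongAt n φ (fun q' ↦ constField x₀ c (φ q')) q := fun c ↦
    (smoothAt_constField x₀ c).comp q hφ
  have hG : ContMDiffAt (𝓡 n) 𝓘(ℝ, E4 →L[ℝ] (Fin 4 → ℝ)) ∞ G q := by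
    refine ContMDiffAt.sum fun i _ ↦ ContMDiffAt.sum fun j _ ↦ ?_
    exact (g.smoothAlongAt_pair (hE (E i)) (hE (E j))).smul contMDiffAt_const
  have hbase : ∀ᶠ q' in 𝓝 q, φ q' ∈
      (trivializationAt E4 (TangentSpace (𝓡 4) : M → Type _) x₀).baseSet :=
    hφ.continuousAt.eventually (eventually_mem_baseSet x₀)
  have hGa : ∀ q', φ q' ∈ (trivializationAt E4 (TangentSpace (𝓡 4) : M → Type _) x₀).baseSet →
      ∀ (c : E4) (j : Fin 4), G q' c j
        = g.val (φ q') (constField x₀ c (φ q')) (constField x₀ (E j) (φ q')) := by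
    intro q' hq' c j
    rw [constField_eq_sum hq' c]
    simp only [G, map_sum, map_smul, _root_.sum_apply, _root_.smul_apply,
      Finset.sum_apply, ContinuousLinearMap.comp_apply, Pi.smul_apply]
    refine Finset.sum_congr rfl fun i _ ↦ ?_
    rw [Finset.sum_eq_single j]
    · simp [E, mul_comm]
    · intro k _ hk
      simp [hk.symm]
    · simp
  have hinj : ∀ q', φ q' ∈ (trivializationAt E4 (TangentSpace (𝓡 4) : M → Type _) x₀).baseSet →
      Function.Injective (G q') := by
    intro q' hq'
    rw [injective_iff_map_eq_zero]
    intro c hc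
    have : constField x₀ c (φ q') = 0 := by
      refine g.nondegenerate _ _ fun w ↦ ?_
      rw [← constField_tcoord hq' w, constField_eq_sum hq' (tcoord x₀ w)]
      simp only [map_sum, map_smul]
      refine Finset.sum_eq_zero fun j _ ↦ ?_
      rw [← hGa q' hq' c j, hc]
      simp
    have h0 : constField x₀ (0 : E4) (φ q') = 0 := by
      rw [constField_eq_symmL hq', map_zero]
    rw [← tcoord_constField hq' c, this, ← h0, tcoord_constField hq']
  have hequiv : ∀ q', φ q' ∈ (trivializationAt E4 (TangentSpace (𝓡 4) : M → Type _) x₀).baseSet →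
      ∃ e : E4 ≃L[ℝ] (Fin 4 → ℝ), (e : E4 →L[ℝ] (Fin 4 → ℝ)) = G q' := by
    intro q' hq'
    refine ⟨(LinearEquiv.ofInjectiveOfFinrankEq (G q').toLinearMap (hinj q' hq')
      (by simp)).toContinuousLinearEquiv, ?_⟩
    ext; rfl
  obtain ⟨e, he⟩ := hequiv q (mem_baseSet_self _)
  have hinv : ContMDiffAt (𝓡 n) 𝓘(ℝ, (Fin 4 → ℝ) →L[ℝ] E4) ∞
      (fun q' ↦ ContinuousLinearMap.inverse (G q')) q := by
    -- Inversion is smooth on invertible operators, so the coordinates of `V`, obtained by applying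
    -- the inverse Gram matrix to its products with the frame, are smooth.
    have h1 := (contDiffAt_map_inverse (n := ∞) e).contMDiffAt
    rw [he] at h1
    exact h1.comp q hG
  have hV : ContMDiffAt (𝓡 n) 𝓘(ℝ, Fin 4 → ℝ) ∞
      (fun q' ↦ fun j ↦ g.val (φ q') (V q') (constField x₀ (E j) (φ q'))) q :=
    contMDiffAt_pi_space.2 fun j ↦ h (E j)
  refine (hinv.clm_apply hV).congr_of_eventuallyEq ?_
  filter_upwards [hbase] with q' hq'
  obtain ⟨e', he'⟩ := hequiv q' hq'
  have : (fun j ↦ g.val (φ q') (V q') (constField x₀ (E j) (φ q'))) = G q' (tcoord x₀ (V q')) := by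
    funext j
    rw [hGa q' hq', constField_tcoord hq']
  rw [this, ← he', ContinuousLinearMap.inverse_equiv]
  simp

end LorentzMetric
end

/-! ### Rules of the Levi-Civita connection and skew-symmetry of the curvature -/

namespace LorentzMetric

variable {M : Type*} [TopologicalSpace M] [ChartedSpace E4 M] [IsManifold (𝓡 4) ∞ M]
  {g : LorentzMetric M}

lemma diffAt_of_smoothAt {X : ∀ x : M, TangentSpace (𝓡 4) x} {x : M} (hX : FieldSmoothAt X x) :
    FieldDiffAt X x := ContMDiffAt.mdifferentiableAt hX (by simp)

lemma eventually_diffAt_of_smoothAt {X : ∀ x : M, TangentSpace (𝓡 4) x} {x : M}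
    (hX : FieldSmoothAt X x) : ∀ᶠ y in 𝓝 x, FieldDiffAt X y := by
  have h1 : ContMDiffAt (𝓡 4) ((𝓡 4).prod 𝓘(ℝ, E4)) 1
    (fun y ↦ Bundle.TotalSpace.mk' E4 (E := (TangentSpace (𝓡 4) : M → Type _)) y (X y)) x :=
    ContMDiffAt.of_le hX (by simp)
  filter_upwards [(contMDiffAt_iff_contMDiffAt_nhds (by decide)).1 h1] with y hy
  exact ContMDiffAt.mdifferentiableAt hy (by decide)

lemma fieldSmoothAt_extend {x : M} (u : TangentSpace (𝓡 4) x) :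
    FieldSmoothAt (FiberBundle.extend E4 u) x :=
  FiberBundle.contMDiffAt_extend (𝓡 4) E4 u

lemma nabla_add {X Y : ∀ x : M, TangentSpace (𝓡 4) x} {x : M} (hX : FieldDiffAt X x)
    (hY : FieldDiffAt Y x) (u : TangentSpace (𝓡 4) x) :
    g.nabla (fun y ↦ X y + Y y) x u = g.nabla X x u + g.nabla Y x u :=
  congrArg (fun A : TangentSpace (𝓡 4) x →L[ℝ] TangentSpace (𝓡 4) x ↦ A u)
    (g.nabla.isCovariantDerivativeOnUniv.add hX hY)

lemma nabla_smul {f : M → ℝ} {Y : ∀ x : M, TangentSpace (𝓡 4) x} {x : M}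
    (hf : MDifferentiableAt (𝓡 4) 𝓘(ℝ, ℝ) f x) (hY : FieldDiffAt Y x)
    (u : TangentSpace (𝓡 4) x) :
    g.nabla (fun y ↦ f y • Y y) x u = f x • g.nabla Y x u + mvfderiv (𝓡 4) f x u • Y x :=
  congrArg (fun A : TangentSpace (𝓡 4) x →L[ℝ] TangentSpace (𝓡 4) x ↦ A u)
    (g.nabla.isCovariantDerivativeOnUniv.leibniz hY hf)

lemma nabla_const_smul (r : ℝ) {Y : ∀ x : M, TangentSpace (𝓡 4) x} {x : M}
    (hY : FieldDiffAt Y x) (u : TangentSpace (𝓡 4) x) :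
    g.nabla (fun y ↦ r • Y y) x u = r • g.nabla Y x u := by
  rw [nabla_smul (f := fun _ ↦ r) mdifferentiableAt_const hY, mvfderiv_const]
  simp

lemma fieldDiffAt_add {X Y : ∀ x : M, TangentSpace (𝓡 4) x} {x : M} (hX : FieldDiffAt X x)
    (hY : FieldDiffAt Y x) : FieldDiffAt (fun y ↦ X y + Y y) x :=
  mdifferentiableAt_add_section hX hY

lemma fieldDiffAt_const_smul (r : ℝ) {Y : ∀ x : M, TangentSpace (𝓡 4) x} {x : M}
    (hY : FieldDiffAt Y x) : FieldDiffAt (fun y ↦ r • Y y) x :=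
  MDifferentiableAt.smul_section (f := fun _ ↦ r) mdifferentiableAt_const hY

lemma nabla_sub {X Y : ∀ x : M, TangentSpace (𝓡 4) x} {x : M} (hX : FieldDiffAt X x)
    (hY : FieldDiffAt Y x) (u : TangentSpace (𝓡 4) x) :
    g.nabla (fun y ↦ X y - Y y) x u = g.nabla X x u - g.nabla Y x u := by
  have h := nabla_add (g := g) hX (fieldDiffAt_const_smul (-1) hY) u
  rw [nabla_const_smul (-1) hY] at h
  simpa [sub_eq_add_neg] using h

lemma nabla_congr {X Y : ∀ x : M, TangentSpace (𝓡 4) x} {x : M} (hX : FieldDiffAt X x)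
    (hY : FieldDiffAt Y x) (h : ∀ᶠ y in 𝓝 x, X y = Y y) : g.nabla X x = g.nabla Y x :=
  g.nabla.isCovariantDerivativeOnUniv.congr_of_eventuallyEq hX hY Filter.univ_mem h

lemma fieldDiffAt_congr {X Y : ∀ x : M, TangentSpace (𝓡 4) x} {x : M} (hX : FieldDiffAt X x)
    (h : ∀ᶠ y in 𝓝 x, Y y = X y) : FieldDiffAt Y x := by
  refine MDifferentiableAt.congr_of_eventuallyEq hX ?_
  filter_upwards [h] with y hy
  rw [hy]

lemma smoothAt_pair {X Y : ∀ x : M, TangentSpace (𝓡 4) x} {x : M} (hX : FieldSmoothAt X x)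
    (hY : FieldSmoothAt Y x) : ContMDiffAt (𝓡 4) 𝓘(ℝ, ℝ) ∞ (g.pair X Y) x :=
  g.smoothAlongAt_pair hX hY

lemma smoothAt_mlieBracket {X Y : ∀ x : M, TangentSpace (𝓡 4) x} {x : M} (hX : FieldSmoothAt X x)
    (hY : FieldSmoothAt Y x) : FieldSmoothAt (VectorField.mlieBracket (𝓡 4) X Y) x := by
  have h1 : IsManifold (𝓡 4) (minSmoothness ℝ 2) M := by
    rw [minSmoothness_of_isRCLikeNormedField]; infer_instance
  have h2 : IsManifold (𝓡 4) ((⊤ : ℕ∞) + 1) M := by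
    change IsManifold (𝓡 4) ∞ M; infer_instance
  exact ContMDiffAt.mlieBracket_vectorField (n := ⊤) (m := ⊤) hX hY (by
    rw [minSmoothness_of_isRCLikeNormedField]; exact le_rfl)

/-- Products with a local frame determine smoothness, and the Koszul formula writes them through
derivatives and brackets of smooth fields. -/
lemma smoothAt_nabla {X Y : ∀ x : M, TangentSpace (𝓡 4) x} {x : M} (hX : FieldSmoothAt X x)
    (hY : FieldSmoothAt Y x) : FieldSmoothAt (fun y ↦ g.nabla Y y (X y)) x := by
  refine g.smoothAlongAt_of_pair (φ := fun y ↦ y) contMDiffAt_id fun c ↦ ?_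
  have hZ := smoothAt_constField x c
  set Z := constField x c
  have hk : ContMDiffAt (𝓡 4) 𝓘(ℝ, ℝ) ∞ (fun y ↦ 1 / 2 * g.koszul Y X Z y) x := by
    refine contMDiffAt_const.mul ?_
    have hp {A B : ∀ x : M, TangentSpace (𝓡 4) x} (hA : FieldSmoothAt A x)
      (hB : FieldSmoothAt B x) : ContMDiffAt (𝓡 4) 𝓘(ℝ, ℝ) ∞ (fun y ↦ g.val y (A y) (B y)) x :=
      g.smoothAlongAt_pair hA hB
    have hb {A B : ∀ x : M, TangentSpace (𝓡 4) x} (hA : FieldSmoothAt A x)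
      (hB : FieldSmoothAt B x) := smoothAt_mlieBracket hA hB
    exact (((((contMDiffAt_mvfderiv_apply (smoothAt_pair hY hZ) hX).add
      (contMDiffAt_mvfderiv_apply (smoothAt_pair hX hZ) hY)).sub
      (contMDiffAt_mvfderiv_apply (smoothAt_pair hX hY) hZ)).add
      (hp (hb hX hY) hZ)).sub (hp (hb hX hZ) hY)).sub (hp (hb hY hZ) hX)
  refine hk.congr_of_eventuallyEq ?_
  filter_upwards [eventually_diffAt_of_smoothAt hX, eventually_diffAt_of_smoothAt hY,
    eventually_diffAt_of_smoothAt hZ]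
    with y h1 h2 h3 using g.val_nabla h1 h2 h3

variable (g) in
/-- The curvature `∇_A ∇_B Y - ∇_B ∇_A Y - ∇_[A, B] Y` of three vector fields. -/
def curv (A B Y : ∀ x : M, TangentSpace (𝓡 4) x) (x : M) : TangentSpace (𝓡 4) x :=
  g.nabla (fun y ↦ g.nabla Y y (B y)) x (A x) - g.nabla (fun y ↦ g.nabla Y y (A y)) x (B x)
    - g.nabla Y x (VectorField.mlieBracket (𝓡 4) A B x)

lemma val_nabla_right {Y Z : ∀ x : M, TangentSpace (𝓡 4) x} {x : M}
    (hY : FieldDiffAt Y x) (hZ : FieldDiffAt Z x) (u : TangentSpace (𝓡 4) x) :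
    mvfderiv (𝓡 4) (g.pair Y Z) x u
      = g.val x (g.nabla Y x u) (Z x) + g.val x (Y x) (g.nabla Z x u) := by
  have := g.nabla_metric (fieldDiffAt_extend u) hY hZ
  simpa using this

/-- Differentiate `g(Y, Z)` along `B` and then `A`, and antisymmetrize: the mixed terms with one
derivative on each factor are symmetric in `A, B` and cancel, and the commutator acts on the
function as `[A, B]`. -/
lemma val_curv {A B Y Z : ∀ x : M, TangentSpace (𝓡 4) x} {x : M} (hA : FieldSmoothAt A x)
    (hB : FieldSmoothAt B x) (hY : FieldSmoothAt Y x) (hZ : FieldSmoothAt Z x) :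
    g.val x (g.curv A B Y x) (Z x) = - g.val x (Y x) (g.curv A B Z x) := by
  have key : ∀ {A B : ∀ x : M, TangentSpace (𝓡 4) x}, FieldSmoothAt A x → FieldSmoothAt B x →
      mvfderiv (𝓡 4) (fun y ↦ mvfderiv (𝓡 4) (g.pair Y Z) y (B y)) x (A x)
        = g.val x (g.nabla (fun y ↦ g.nabla Y y (B y)) x (A x)) (Z x)
          + g.val x (g.nabla Y x (B x)) (g.nabla Z x (A x))
          + (g.val x (g.nabla Y x (A x)) (g.nabla Z x (B x))
          + g.val x (Y x) (g.nabla (fun y ↦ g.nabla Z y (B y)) x (A x))) := by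
    intro A B hA hB
    have dYB := diffAt_of_smoothAt (smoothAt_nabla (g := g) hB hY)
    have dZB := diffAt_of_smoothAt (smoothAt_nabla (g := g) hB hZ)
    have e : (fun y ↦ mvfderiv (𝓡 4) (g.pair Y Z) y (B y)) =ᶠ[𝓝 x]
        g.pair (fun y ↦ g.nabla Y y (B y)) Z + g.pair Y (fun y ↦ g.nabla Z y (B y)) := by
      filter_upwards [eventually_diffAt_of_smoothAt hY,
        eventually_diffAt_of_smoothAt hZ] with y h1 h2
      exact val_nabla_right h1 h2 (B y)
    rw [mvfderiv_congr e, mvfderiv_add (mdiff_pair dYB (diffAt_of_smoothAt hZ))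
        (mdiff_pair (diffAt_of_smoothAt hY) dZB),
      _root_.add_apply, val_nabla_right dYB (diffAt_of_smoothAt hZ),
      val_nabla_right (diffAt_of_smoothAt hY) dZB]
  have hp := smoothAt_pair (g := g) hY hZ
  have hb := mvfderiv_mlieBracket (hp.of_le ENat.LEInfty.out) (diffAt_of_smoothAt hA)
    (diffAt_of_smoothAt hB)
    ((contMDiffAt_mvfderiv_apply hp hA).mdifferentiableAt (by simp))
    ((contMDiffAt_mvfderiv_apply hp hB).mdifferentiableAt (by simp))
  rw [key hA hB, key hB hA, val_nabla_right (diffAt_of_smoothAt hY) (diffAt_of_smoothAt hZ)] at hb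
  simp only [curv, map_sub, _root_.sub_apply]
  linarith

end LorentzMetric

/-! ### Symmetries of the Riemann tensor and the second covariant derivative -/

namespace LorentzMetric

variable {M : Type*} [TopologicalSpace M] [ChartedSpace E4 M] [IsManifold (𝓡 4) ∞ M]
  {g : LorentzMetric M}

/-- Vanishing torsion used twice. The grouping is chosen so that the cyclic sum of the left side is
the cyclic sum of curvatures, which turns the Jacobi identity into the first Bianchi identity. -/
lemma nabla_mlieBracket {A B C : ∀ x : M, TangentSpace (𝓡 4) x} {x : M} (hA : FieldSmoothAt A x)
    (hB : FieldSmoothAt B x) (hC : FieldSmoothAt C x) :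
    g.nabla (fun y ↦ g.nabla C y (B y)) x (A x) - g.nabla (fun y ↦ g.nabla B y (C y)) x (A x)
      - g.nabla A x (VectorField.mlieBracket (𝓡 4) B C x)
      = VectorField.mlieBracket (𝓡 4) A (VectorField.mlieBracket (𝓡 4) B C) x := by
  have h1 := diffAt_of_smoothAt (smoothAt_nabla (g := g) hB hC)
  have h2 := diffAt_of_smoothAt (smoothAt_nabla (g := g) hC hB)
  have h3 := diffAt_of_smoothAt (smoothAt_mlieBracket hB hC)
  have e : ∀ᶠ y in 𝓝 x, VectorField.mlieBracket (𝓡 4) B C y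
      = g.nabla C y (B y) - g.nabla B y (C y) := by
    filter_upwards [eventually_diffAt_of_smoothAt hB, eventually_diffAt_of_smoothAt hC]
      with y h4 h5 using (g.nabla_torsion_free h4 h5).symm
  rw [← nabla_sub h1 h2, ← nabla_congr h3 (fieldDiffAt_congr h3 (e.mono fun y hy ↦ hy.symm)) e,
    g.nabla_torsion_free (diffAt_of_smoothAt hA) h3]

/-- The first Bianchi identity for vector fields. -/
lemma curv_cyclic {A B C : ∀ x : M, TangentSpace (𝓡 4) x} {x : M} (hA : FieldSmoothAt A x)
    (hB : FieldSmoothAt B x) (hC : FieldSmoothAt C x) :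
    g.curv A B C x + g.curv B C A x + g.curv C A B x = 0 := by
  have h1 := nabla_mlieBracket (g := g) hA hB hC
  have h2 := nabla_mlieBracket (g := g) hB hC hA
  have h3 := nabla_mlieBracket (g := g) hC hA hB
  have hm : IsManifold (𝓡 4) (minSmoothness ℝ 3) M := by
    rw [minSmoothness_of_isRCLikeNormedField]; infer_instance
  have h2le {X : ∀ x : M, TangentSpace (𝓡 4) x} (hX : FieldSmoothAt X x) :
      ContMDiffAt (𝓡 4) ((𝓡 4).prod 𝓘(ℝ, E4)) (minSmoothness ℝ 2)
        (fun y ↦ Bundle.TotalSpace.mk' E4 (E := (TangentSpace (𝓡 4) : M → Type _)) y (X y)) x := by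
    rw [minSmoothness_of_isRCLikeNormedField]
    exact ContMDiffAt.of_le hX ENat.LEInfty.out
  have hJ := VectorField.leibniz_identity_mlieBracket_apply (h2le hA) (h2le hB) (h2le hC)
  have hn : -VectorField.mlieBracket (𝓡 4) C A = (-1 : ℝ) • VectorField.mlieBracket (𝓡 4) C A := by
    simp
  rw [VectorField.mlieBracket_swap_apply (V := VectorField.mlieBracket (𝓡 4) A B),
    VectorField.mlieBracket_swap (V := A) (W := C), hn,
    VectorField.mlieBracket_const_smul_right (diffAt_of_smoothAt (smoothAt_mlieBracket hC hA)),
    ← h1, ← h2, ← h3] at hJ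
  simp only [curv]
  refine Eq.trans ?_ (sub_eq_zero.2 hJ)
  module

lemma curv_swap (A B Y : ∀ x : M, TangentSpace (𝓡 4) x) (x : M) :
    g.curv A B Y x = - g.curv B A Y x := by
  simp only [curv]
  rw [VectorField.mlieBracket_swap_apply (V := A), map_neg]
  abel

lemma curvature_eq_curv (x : M) (a b c : TangentSpace (𝓡 4) x) :
    g.curvature x a b c = g.curv (FiberBundle.extend E4 a) (FiberBundle.extend E4 b)
      (FiberBundle.extend E4 c) x := by
  simp only [curvature, curv, FiberBundle.extend_apply_self]

/-- Tensoriality in the last slot: by skew-symmetry the derivatives can be moved from `Y` onto a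
test field, after which only the value `Y x` enters. -/
lemma curv_extend {Y : ∀ x : M, TangentSpace (𝓡 4) x} {x : M} (hY : FieldSmoothAt Y x)
    (a b : TangentSpace (𝓡 4) x) :
    g.curv (FiberBundle.extend E4 a) (FiberBundle.extend E4 b) Y x
      = g.curvature x a b (Y x) := by
  refine ext_val (g := g) fun w ↦ ?_
  have ha := fieldSmoothAt_extend a
  have hb := fieldSmoothAt_extend b
  have hw := fieldSmoothAt_extend w
  have h1 := val_curv (g := g) ha hb hY hw
  have h2 := val_curv (g := g) ha hb (fieldSmoothAt_extend (Y x)) hw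
  rw [curvature_eq_curv]
  simp only [FiberBundle.extend_apply_self] at h1 h2
  rw [h1, h2]

lemma val_curvature (x : M) (a b c d : TangentSpace (𝓡 4) x) :
    g.val x (g.curvature x a b c) d = - g.val x c (g.curvature x a b d) := by
  have h := val_curv (g := g) (fieldSmoothAt_extend a) (fieldSmoothAt_extend b)
    (fieldSmoothAt_extend c) (fieldSmoothAt_extend d)
  simpa only [curvature_eq_curv, FiberBundle.extend_apply_self] using h

lemma riemann_swap_left (x : M) (a b c d : TangentSpace (𝓡 4) x) :
    g.riemann x a b c d = - g.riemann x b a c d := by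
  simp only [riemann]
  rw [val_curvature, g.symm]

lemma riemann_swap_right (x : M) (a b c d : TangentSpace (𝓡 4) x) :
    g.riemann x a b c d = - g.riemann x a b d c := by
  simp only [riemann, curvature_eq_curv]
  rw [curv_swap, map_neg, _root_.neg_apply]

lemma riemann_cyclic (x : M) (a b c d : TangentSpace (𝓡 4) x) :
    g.riemann x a b c d + g.riemann x a c d b + g.riemann x a d b c = 0 := by
  have h := curv_cyclic (g := g) (fieldSmoothAt_extend b) (fieldSmoothAt_extend c)
    (fieldSmoothAt_extend d)
  have h' := congrArg (fun v ↦ g.val x v a) h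
  simp only [map_add, _root_.add_apply, map_zero, _root_.zero_apply] at h'
  simp only [riemann, curvature_eq_curv]
  linarith

/-- Formal consequence of four Bianchi identities and skewness in each pair. -/
lemma riemann_pair_symm (x : M) (a b c d : TangentSpace (𝓡 4) x) :
    g.riemann x a b c d = g.riemann x c d a b := by
  have h1 := g.riemann_cyclic x a b c d
  have h2 := g.riemann_cyclic x b c d a
  have h3 := g.riemann_cyclic x c d a b
  have h4 := g.riemann_cyclic x d a b c
  have := g.riemann_swap_left x
  have := g.riemann_swap_right x
  grind

variable (g) in
/-- The second covariant derivative `∇²_{a, b} Y` of a vector field. -/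
def hess (Y : ∀ x : M, TangentSpace (𝓡 4) x) (x : M) (a b : TangentSpace (𝓡 4) x) :
    TangentSpace (𝓡 4) x :=
  g.nabla (fun y ↦ g.nabla Y y (FiberBundle.extend E4 b y)) x a
    - g.nabla Y x (g.nabla (FiberBundle.extend E4 b) x a)

/-- The Ricci identity: by vanishing torsion the first-order corrections combine into the derivative
along the bracket. -/
lemma hess_sub_hess {Y : ∀ x : M, TangentSpace (𝓡 4) x} {x : M} (hY : FieldSmoothAt Y x)
    (a b : TangentSpace (𝓡 4) x) :
    g.hess Y x a b - g.hess Y x b a = g.curvature x a b (Y x) := by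
  have ht := g.nabla_torsion_free (fieldDiffAt_extend a) (fieldDiffAt_extend b)
  rw [← curv_extend hY]
  simp only [hess, curv]
  rw [← ht, map_sub]
  simp only [FiberBundle.extend_apply_self]
  abel

lemma fieldDiffAt_nabla_extend {Y : ∀ x : M, TangentSpace (𝓡 4) x} {x : M} (hY : FieldSmoothAt Y x)
    (b : TangentSpace (𝓡 4) x) :
    FieldDiffAt (fun y ↦ g.nabla Y y (FiberBundle.extend E4 b y)) x :=
  diffAt_of_smoothAt (smoothAt_nabla (fieldSmoothAt_extend b) hY)

lemma extend_add (x : M) (b c : TangentSpace (𝓡 4) x) :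
    ∀ᶠ y in 𝓝 x, FiberBundle.extend E4 (b + c) y
      = FiberBundle.extend E4 b y + FiberBundle.extend E4 c y := by
  filter_upwards [eventually_mem_baseSet x] with y hy
  simp only [extend_eq_constField, tcoord_add (mem_baseSet_self x), constField_add hy]

lemma extend_smul (x : M) (r : ℝ) (c : TangentSpace (𝓡 4) x) :
    ∀ᶠ y in 𝓝 x, FiberBundle.extend E4 (r • c) y = r • FiberBundle.extend E4 c y := by
  filter_upwards [eventually_mem_baseSet x] with y hy
  simp only [extend_eq_constField, tcoord_smul (mem_baseSet_self x), constField_smul hy]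

lemma hess_add_right {Y : ∀ x : M, TangentSpace (𝓡 4) x} {x : M} (hY : FieldSmoothAt Y x)
    (a b c : TangentSpace (𝓡 4) x) :
    g.hess Y x a (b + c) = g.hess Y x a b + g.hess Y x a c := by
  have hb := fieldDiffAt_extend b
  have hc := fieldDiffAt_extend c
  have h1 := nabla_congr (g := g) (fieldDiffAt_extend (b + c)) (fieldDiffAt_add hb hc)
    (extend_add x b c)
  have hb' := fieldDiffAt_nabla_extend (g := g) hY b
  have hc' := fieldDiffAt_nabla_extend (g := g) hY c
  have h2 := nabla_congr (g := g) (fieldDiffAt_nabla_extend (g := g) hY (b + c))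
    (fieldDiffAt_add hb' hc')
    ((extend_add x b c).mono fun y hy ↦ by rw [hy, map_add])
  simp only [hess]
  rw [h1, h2, nabla_add hb hc, nabla_add hb' hc', map_add]
  abel

lemma hess_smul_right {Y : ∀ x : M, TangentSpace (𝓡 4) x} {x : M} (hY : FieldSmoothAt Y x)
    (r : ℝ) (a c : TangentSpace (𝓡 4) x) :
    g.hess Y x a (r • c) = r • g.hess Y x a c := by
  have hc := fieldDiffAt_extend c
  have h1 := nabla_congr (g := g) (fieldDiffAt_extend (r • c)) (fieldDiffAt_const_smul r hc)
    (extend_smul x r c)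
  have hc' := fieldDiffAt_nabla_extend (g := g) hY c
  have h2 := nabla_congr (g := g) (fieldDiffAt_nabla_extend (g := g) hY (r • c))
    (fieldDiffAt_const_smul r hc')
    ((extend_smul x r c).mono fun y hy ↦ by rw [hy, map_smul])
  simp only [hess]
  rw [h1, h2, nabla_const_smul r hc, nabla_const_smul r hc', map_smul, smul_sub]

/-- The second covariant derivative in the second slot, as a linear map. -/
def hessLin {Y : ∀ x : M, TangentSpace (𝓡 4) x} {x : M} (hY : FieldSmoothAt Y x)
    (a : TangentSpace (𝓡 4) x) : TangentSpace (𝓡 4) x →ₗ[ℝ] TangentSpace (𝓡 4) x where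
  toFun := g.hess Y x a
  map_add' := hess_add_right hY a
  map_smul' r c := hess_smul_right hY r a c

/-! ### Killing fields -/

namespace IsKilling

variable {ξ : ∀ x : M, TangentSpace (𝓡 4) x} (hξ : g.IsKilling ξ)

include hξ

lemma smoothAt (x : M) : FieldSmoothAt ξ x := hξ.smooth x

lemma val_nabla_add {X Y : ∀ x : M, TangentSpace (𝓡 4) x} {x : M} (hX : FieldDiffAt X x)
    (hY : FieldDiffAt Y x) :
    g.val x (g.nabla ξ x (X x)) (Y x) + g.val x (X x) (g.nabla ξ x (Y x)) = 0 := by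
  have h := hξ.lie_metric X Y x hX hY
  have hd := diffAt_of_smoothAt (hξ.smoothAt x)
  rw [← g.nabla_torsion_free hd hX, ← g.nabla_torsion_free hd hY, val_nabla_right hX hY] at h
  simp only [map_sub, _root_.sub_apply] at h
  linarith

/-- The Killing equation. -/
lemma val_nabla_swap (x : M) (u w : TangentSpace (𝓡 4) x) :
    g.val x (g.nabla ξ x u) w = - g.val x u (g.nabla ξ x w) := by
  have := hξ.val_nabla_add (fieldDiffAt_extend u) (fieldDiffAt_extend w)
  simp only [FiberBundle.extend_apply_self] at this
  linarith

/-- The Killing equation says that `∇ξ` is skew at every point, so its covariant derivative is skew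
too. -/
lemma val_hess_swap (x : M) (a b c : TangentSpace (𝓡 4) x) :
    g.val x (g.hess ξ x a b) c = - g.val x b (g.hess ξ x a c) := by
  have hb := fieldDiffAt_extend b
  have hc := fieldDiffAt_extend c
  have hb' := fieldDiffAt_nabla_extend (g := g) (hξ.smoothAt x) b
  have hc' := fieldDiffAt_nabla_extend (g := g) (hξ.smoothAt x) c
  have h1 := val_nabla_right (g := g) hb' hc a
  have h2 := val_nabla_right (g := g) hb hc' a
  have e : g.pair (fun y ↦ g.nabla ξ y (FiberBundle.extend E4 b y)) (FiberBundle.extend E4 c)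
      = - g.pair (FiberBundle.extend E4 b) (fun y ↦ g.nabla ξ y (FiberBundle.extend E4 c y)) := by
    funext y
    exact hξ.val_nabla_swap y _ _
  rw [e, mvfderiv_neg, _root_.neg_apply, h2] at h1
  simp only [FiberBundle.extend_apply_self] at h1
  have h3 := hξ.val_nabla_swap x (g.nabla (FiberBundle.extend E4 b) x a) c
  have h4 := hξ.val_nabla_swap x b (g.nabla (FiberBundle.extend E4 c) x a)
  simp only [hess, map_sub, _root_.sub_apply]
  linarith

/-- The Hessian of a Killing field is a curvature term. -/
lemma val_hess (x : M) (a b c : TangentSpace (𝓡 4) x) :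
    g.val x (g.hess ξ x a b) c = - g.riemann x a (ξ x) b c := by
  have key : ∀ a b c, g.val x (g.hess ξ x a b) c - g.val x (g.hess ξ x b a) c
      = g.riemann x c (ξ x) a b := by
    intro a b c
    rw [riemann, ← hess_sub_hess (hξ.smoothAt x), map_sub, _root_.sub_apply]
  have hs : ∀ a b c, g.val x (g.hess ξ x a b) c = - g.val x (g.hess ξ x a c) b := by
    intro a b c
    rw [hξ.val_hess_swap, g.symm]
  -- As in the Koszul argument, `hs` (skewness in the last two slots) and `key` (the skew part in
  -- the first two) determine the trilinear form: `k1 - k2 + k3` isolates twice the wanted term, and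
  -- the Bianchi identity merges the three curvatures into one.
  have k1 := key a b c
  have k2 := key b c a
  have k3 := key c a b
  have s1 := hs b c a
  have s2 := hs c b a
  have s3 := hs a c b
  have b1 := g.riemann_cyclic x (ξ x) a b c
  have r1 := g.riemann_swap_left x (ξ x) a b c
  have r2 := g.riemann_swap_left x (ξ x) b c a
  have r3 := g.riemann_swap_left x (ξ x) c a b
  linarith

end IsKilling

end LorentzMetric

/-! ### Pointwise differentiation rules for functions -/

section

variable {E : Type*} [NormedAddCommGroup E] [NormedSpace ℝ E]
  {B : Type*} [TopologicalSpace B] {I : ModelWithCorners ℝ E B}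
  {N : Type*} [TopologicalSpace N] [ChartedSpace B N]

lemma mvfderiv_sum {κ : Type} (s : Finset κ) {f : κ → N → ℝ} {q : N}
    (hf : ∀ i ∈ s, MDifferentiableAt I 𝓘(ℝ, ℝ) (f i) q) (u : TangentSpace I q) :
    mvfderiv I (fun q ↦ ∑ i ∈ s, f i q) q u = ∑ i ∈ s, mvfderiv I (f i) q u := by
  classical
  induction s using Finset.induction_on with
  | empty => simp [mvfderiv_const]
  | insert i s hi ih =>
    have h0 : ∀ j ∈ s, MDifferentiableAt I 𝓘(ℝ, ℝ) (f j) q :=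
      fun j hj ↦ hf j (Finset.mem_insert_of_mem hj)
    have hs : MDifferentiableAt I 𝓘(ℝ, ℝ) (fun q ↦ ∑ i ∈ s, f i q) q := by
      simpa [Finset.sum_fn] using MDifferentiableAt.sum h0
    have h := mvfderiv_add (hf i (Finset.mem_insert_self i s)) hs
    simp only [Finset.sum_insert hi]
    rw [← ih h0]
    exact congrArg (fun A : TangentSpace I q →L[ℝ] ℝ ↦ A u) h

lemma mvfderiv_clm_comp {F F' : Type*} [NormedAddCommGroup F] [NormedSpace ℝ F]
    [NormedAddCommGroup F'] [NormedSpace ℝ F'] (A : F →L[ℝ] F') {h : N → F} {q : N}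
    (hh : MDifferentiableAt I 𝓘(ℝ, F) h q) (u : TangentSpace I q) :
    mvfderiv I (fun q ↦ A (h q)) q u = A (mvfderiv I h q u) := by
  have := mvfderiv_comp_mfderiv (h := A) (φ := h) (q := q) A.mdifferentiableAt hh u
  refine this.trans ?_
  rw [mvfderiv, A.mfderiv_eq]
  rfl

lemma mvfderiv_mul_apply {f h : N → ℝ} {q : N} (hf : MDifferentiableAt I 𝓘(ℝ, ℝ) f q)
    (hh : MDifferentiableAt I 𝓘(ℝ, ℝ) h q) (u : TangentSpace I q) :
    mvfderiv I (fun q ↦ f q * h q) q u = f q * mvfderiv I h q u + h q * mvfderiv I f q u :=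
  congrArg (fun A : TangentSpace I q →L[ℝ] ℝ ↦ A u) (mvfderiv_mul hf hh)

lemma mvfderiv_add_apply {f h : N → ℝ} {q : N} (hf : MDifferentiableAt I 𝓘(ℝ, ℝ) f q)
    (hh : MDifferentiableAt I 𝓘(ℝ, ℝ) h q) (u : TangentSpace I q) :
    mvfderiv I (fun q ↦ f q + h q) q u = mvfderiv I f q u + mvfderiv I h q u :=
  congrArg (fun A : TangentSpace I q →L[ℝ] ℝ ↦ A u) (mvfderiv_add hf hh)

lemma mvfderiv_neg_apply {f : N → ℝ} {q : N} (u : TangentSpace I q) :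
    mvfderiv I (fun q ↦ - f q) q u = - mvfderiv I f q u :=
  congrArg (fun A : TangentSpace I q →L[ℝ] ℝ ↦ A u) (mvfderiv_neg (g := f) (x := q))

end

/-! ### The connection along the hypersurface: local formula and metric compatibility -/

namespace LorentzMetric

variable {M : Type*} [TopologicalSpace M] [ChartedSpace E4 M] [IsManifold (𝓡 4) ∞ M]
  {H : Type*} [TopologicalSpace H] [ChartedSpace E3 H]
  {g : LorentzMetric M} {ι : H → M}

/-- A local frame of the tangent bundle around `x₀`. -/
abbrev frame (x₀ : M) (i : Fin 4) : ∀ x : M, TangentSpace (𝓡 4) x :=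
  constField x₀ (EuclideanSpace.single i 1)

lemma smoothAt_frame (x₀ : M) (i : Fin 4) : FieldSmoothAt (frame x₀ i) x₀ :=
  smoothAt_constField x₀ _

omit [ChartedSpace E3 H] in
lemma eventually_eq_sum_frame {p : H} (hι : ContinuousAt ι p)
    (V : ∀ p : H, TangentSpace (𝓡 4) (ι p)) :
    ∀ᶠ q in 𝓝 p, V q = ∑ i, tcoord (ι p) (V q) i • frame (ι p) i (ι q) := by
  filter_upwards [hι.eventually (eventually_mem_baseSet (ι p))] with q hq
  rw [← constField_eq_sum hq, constField_tcoord hq]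

lemma eq_sum_frame (x : M) (v : TangentSpace (𝓡 4) x) :
    v = ∑ i, tcoord x v i • frame x i x := by
  rw [← constField_eq_sum (mem_baseSet_self x), constField_tcoord (mem_baseSet_self x)]

lemma extend_frame (x : M) (i : Fin 4) : FiberBundle.extend E4 (frame x i x) = frame x i := by
  rw [extend_eq_constField, frame, tcoord_constField (mem_baseSet_self x)]

variable (g) in
/-- `∇_a` at `x` of the local extension, as a function of the extended vector. -/
def nablaExtend (x : M) (a : TangentSpace (𝓡 4) x) :
    TangentSpace (𝓡 4) x →ₗ[ℝ] TangentSpace (𝓡 4) x where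
  toFun b := g.nabla (FiberBundle.extend E4 b) x a
  map_add' b c := by
    have hb := fieldDiffAt_extend b
    have hc := fieldDiffAt_extend c
    rw [nabla_congr (g := g) (fieldDiffAt_extend (b + c)) (fieldDiffAt_add hb hc)
      (extend_add x b c), nabla_add hb hc]
  map_smul' r c := by
    have hc := fieldDiffAt_extend c
    rw [nabla_congr (g := g) (fieldDiffAt_extend (r • c)) (fieldDiffAt_const_smul r hc)
      (extend_smul x r c), nabla_const_smul r hc]
    rfl

lemma tcoord_diffAt {V : ∀ p : H, TangentSpace (𝓡 4) (ι p)} {p : H} (hV : DiffAlongAt 3 ι V p)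
    (i : Fin 4) : MDifferentiableAt (𝓡 3) 𝓘(ℝ, ℝ) (fun q ↦ tcoord (ι p) (V q) i) p :=
  (EuclideanSpace.proj i : E4 →L[ℝ] ℝ).mdifferentiableAt.comp p (diffAlongAt_iff.1 hV).2

/-- The second term of the definition is linear in the value `V p`, and the extension of a frame
vector is the frame field itself, so one fixed frame can be used throughout. -/
lemma nablaAlong_eq_sum {V : ∀ p : H, TangentSpace (𝓡 4) (ι p)} {p : H}
    (hV : DiffAlongAt 3 ι V p) (u : TangentSpace (𝓡 3) p) :
    nablaAlong g ι V p u = ∑ i,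
      (mvfderiv (𝓡 3) (fun q ↦ tcoord (ι p) (V q) i) p u • frame (ι p) i (ι p)
        + tcoord (ι p) (V p) i • g.nabla (frame (ι p) i) (ι p) (push ι p u)) := by
  rw [Finset.sum_add_distrib]
  unfold nablaAlong
  congr 1
  · have h1 := constField_eq_sum (mem_baseSet_self (ι p))
      (mvfderiv (𝓡 3) (fun q ↦ tcoord (ι p) (V q)) p u)
    refine h1.trans (Finset.sum_congr rfl fun i _ ↦ ?_)
    rw [mvfderiv_clm_comp (EuclideanSpace.proj i : E4 →L[ℝ] ℝ) (diffAlongAt_iff.1 hV).2 u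
      |> (id : mvfderiv (𝓡 3) (fun q ↦ tcoord (ι p) (V q) i) p u
        = (mvfderiv (𝓡 3) (fun q ↦ tcoord (ι p) (V q)) p u) i → _)]
  · change nablaExtend g (ι p) (push ι p u) (V p) = _
    conv_lhs => rw [eq_sum_frame (ι p) (V p), map_sum]
    refine Finset.sum_congr rfl fun i _ ↦ ?_
    rw [map_smul]
    congr 1
    change g.nabla (FiberBundle.extend E4 (frame (ι p) i (ι p))) (ι p) _ = _
    rw [extend_frame]

lemma diffAlongAt_comp {Y : ∀ x : M, TangentSpace (𝓡 4) x} {p : H} (hY : FieldDiffAt Y (ι p))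
    (hι : MDifferentiableAt (𝓡 3) (𝓡 4) ι p) : DiffAlongAt 3 ι (fun q ↦ Y (ι q)) p :=
  MDifferentiableAt.comp p hY hι

/-- The derivative of a vector field along `ι` is compatible with the metric. -/
lemma mvfderiv_val {V W : ∀ p : H, TangentSpace (𝓡 4) (ι p)} {p : H} (hV : DiffAlongAt 3 ι V p)
    (hW : DiffAlongAt 3 ι W p) (u : TangentSpace (𝓡 3) p) :
    mvfderiv (𝓡 3) (fun q ↦ g.val (ι q) (V q) (W q)) p u
      = g.val (ι p) (nablaAlong g ι V p u) (W p) + g.val (ι p) (V p) (nablaAlong g ι W p u) := by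
  have hι := (diffAlongAt_iff.1 hV).1
  have hpair : ∀ i j, MDifferentiableAt (𝓡 4) 𝓘(ℝ, ℝ) (g.pair (frame (ι p) i) (frame (ι p) j))
    (ι p) := fun i j ↦ mdiff_pair (diffAt_of_smoothAt (smoothAt_frame _ i))
      (diffAt_of_smoothAt (smoothAt_frame _ j))
  have hpι : ∀ i j, MDifferentiableAt (𝓡 3) 𝓘(ℝ, ℝ)
    (fun q ↦ g.val (ι q) (frame (ι p) i (ι q)) (frame (ι p) j (ι q))) p :=
    fun i j ↦ (hpair i j).comp p hι
  have hd : ∀ i j, mvfderiv (𝓡 3)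
      (fun q ↦ g.val (ι q) (frame (ι p) i (ι q)) (frame (ι p) j (ι q))) p u
      = g.val (ι p) (g.nabla (frame (ι p) i) (ι p) (push ι p u)) (frame (ι p) j (ι p))
        + g.val (ι p) (frame (ι p) i (ι p)) (g.nabla (frame (ι p) j) (ι p) (push ι p u)) := by
    intro i j
    rw [← val_nabla_right (diffAt_of_smoothAt (smoothAt_frame _ i))
      (diffAt_of_smoothAt (smoothAt_frame _ j))]
    exact mvfderiv_comp_mfderiv (hpair i j) hι u
  -- In the frame only the coefficients depend on the fields along `ι`. The Gram functions are
  -- pulled back from `M`, where metric compatibility and the chain rule apply.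
  have e : (fun q ↦ g.val (ι q) (V q) (W q)) =ᶠ[𝓝 p] fun q ↦ ∑ i, ∑ j,
      tcoord (ι p) (V q) i * (tcoord (ι p) (W q) j
        * g.val (ι q) (frame (ι p) i (ι q)) (frame (ι p) j (ι q))) := by
    filter_upwards [eventually_eq_sum_frame hι.continuousAt V,
      eventually_eq_sum_frame hι.continuousAt W] with q h1 h2
    conv_lhs => rw [h1, h2]
    simp only [map_sum, map_smul, _root_.sum_apply, _root_.smul_apply, smul_eq_mul,
      Finset.mul_sum]
    rw [Finset.sum_comm]
    exact Finset.sum_congr rfl fun i _ ↦ Finset.sum_congr rfl fun j _ ↦ by ring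
  have t := tcoord_diffAt hV
  have t' := tcoord_diffAt hW
  have hterm : ∀ i j, MDifferentiableAt (𝓡 3) 𝓘(ℝ, ℝ) (fun q ↦ tcoord (ι p) (V q) i *
      (tcoord (ι p) (W q) j * g.val (ι q) (frame (ι p) i (ι q)) (frame (ι p) j (ι q)))) p :=
    fun i j ↦ (t i).mul ((t' j).mul (hpι i j))
  have hsum : ∀ i, MDifferentiableAt (𝓡 3) 𝓘(ℝ, ℝ) (fun q ↦ ∑ j, tcoord (ι p) (V q) i *
      (tcoord (ι p) (W q) j * g.val (ι q) (frame (ι p) i (ι q)) (frame (ι p) j (ι q)))) p := by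
    intro i
    have := MDifferentiableAt.sum (t := Finset.univ) (fun j _ ↦ hterm i j)
    simpa [Finset.sum_fn] using this
  rw [mvfderiv_congr e, mvfderiv_sum _ (fun i _ ↦ hsum i), nablaAlong_eq_sum hV,
    nablaAlong_eq_sum hW]
  have hr : ∀ z, g.val (ι p) z (W p) = ∑ j, tcoord (ι p) (W p) j
      * g.val (ι p) z (frame (ι p) j (ι p)) := by
    intro z
    conv_lhs => rw [eq_sum_frame (ι p) (W p)]
    simp only [map_sum, map_smul, smul_eq_mul]
  have hl : ∀ z, g.val (ι p) (V p) z = ∑ i, tcoord (ι p) (V p) i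
      * g.val (ι p) (frame (ι p) i (ι p)) z := by
    intro z
    conv_lhs => rw [eq_sum_frame (ι p) (V p)]
    simp only [map_sum, map_smul, _root_.sum_apply, _root_.smul_apply, smul_eq_mul]
  rw [hr, hl]
  simp only [map_sum, map_smul, map_add, _root_.sum_apply, _root_.smul_apply, _root_.add_apply,
    smul_eq_mul, Finset.mul_sum]
  rw [Finset.sum_comm (f := fun j i ↦ tcoord (ι p) (W p) j * _), ← Finset.sum_add_distrib]
  refine Finset.sum_congr rfl fun i _ ↦ ?_
  rw [← Finset.sum_add_distrib, mvfderiv_sum _ (fun j _ ↦ hterm i j)]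
  refine Finset.sum_congr rfl fun j _ ↦ ?_
  rw [mvfderiv_mul_apply (h := fun q ↦ tcoord (ι p) (W q) j
    * g.val (ι q) (frame (ι p) i (ι q)) (frame (ι p) j (ι q))) (t i) ((t' j).mul (hpι i j)),
    mvfderiv_mul_apply (t' j) (hpι i j), hd]
  ring

end LorentzMetric

/-! ### Leibniz rules along the hypersurface -/

namespace LorentzMetric

variable {M : Type*} [TopologicalSpace M] [ChartedSpace E4 M] [IsManifold (𝓡 4) ∞ M]
  {H : Type*} [TopologicalSpace H] [ChartedSpace E3 H]
  {g : LorentzMetric M} {ι : H → M}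

lemma constField_zero (x : M) : constField x (0 : E4) x = 0 := by
  rw [constField_eq_symmL (mem_baseSet_self x), map_zero]

/-- The extension has locally constant coordinates, so the coordinate derivative in the definition
drops out. -/
lemma nablaAlong_extend {p : H} (hι : MDifferentiableAt (𝓡 3) (𝓡 4) ι p)
    (w : TangentSpace (𝓡 4) (ι p)) (u : TangentSpace (𝓡 3) p) :
    nablaAlong g ι (fun q ↦ FiberBundle.extend E4 w (ι q)) p u
      = g.nabla (FiberBundle.extend E4 w) (ι p) (push ι p u) := by
  have e : (fun q ↦ tcoord (ι p) (FiberBundle.extend E4 w (ι q))) =ᶠ[𝓝 p]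
      fun _ ↦ tcoord (ι p) w := by
    filter_upwards [hι.continuousAt.eventually (eventually_mem_baseSet (ι p))] with q hq
    rw [extend_eq_constField, tcoord_constField hq]
  have h0 : mvfderiv (𝓡 3) (fun q ↦ tcoord (ι p) (FiberBundle.extend E4 w (ι q))) p u = 0 := by
    rw [mvfderiv_congr e, mvfderiv_const]; rfl
  have h1 : nablaAlong g ι (fun q ↦ FiberBundle.extend E4 w (ι q)) p u
      = constField (ι p) (mvfderiv (𝓡 3)
        (fun q ↦ tcoord (ι p) (FiberBundle.extend E4 w (ι q))) p u) (ι p)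
        + g.nabla (FiberBundle.extend E4 (FiberBundle.extend E4 w (ι p))) (ι p) (push ι p u) := rfl
  rw [h1, h0, constField_zero, zero_add, FiberBundle.extend_apply_self]

/-- Expresses the derivative through scalar functions only; with nondegeneracy, the algebraic rules
for `nablaAlong` reduce to rules for `mvfderiv`. -/
lemma val_nablaAlong {V : ∀ p : H, TangentSpace (𝓡 4) (ι p)} {p : H} (hV : DiffAlongAt 3 ι V p)
    (u : TangentSpace (𝓡 3) p) (w : TangentSpace (𝓡 4) (ι p)) :
    g.val (ι p) (nablaAlong g ι V p u) w
      = mvfderiv (𝓡 3) (fun q ↦ g.val (ι q) (V q) (FiberBundle.extend E4 w (ι q))) p u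
        - g.val (ι p) (V p) (g.nabla (FiberBundle.extend E4 w) (ι p) (push ι p u)) := by
  have hι := (diffAlongAt_iff.1 hV).1
  have h := mvfderiv_val (g := g) hV (diffAlongAt_comp (fieldDiffAt_extend w) hι) u
  rw [nablaAlong_extend hι, FiberBundle.extend_apply_self] at h
  linarith

lemma nablaAlong_congr {V W : ∀ p : H, TangentSpace (𝓡 4) (ι p)} {p : H}
    (h : ∀ᶠ q in 𝓝 p, V q = W q) (u : TangentSpace (𝓡 3) p) :
    nablaAlong g ι V p u = nablaAlong g ι W p u := by
  have e : (fun q ↦ tcoord (ι p) (V q)) =ᶠ[𝓝 p] fun q ↦ tcoord (ι p) (W q) := by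
    filter_upwards [h] with q hq
    rw [hq]
  change constField (ι p) (mvfderiv (𝓡 3) (fun q ↦ tcoord (ι p) (V q)) p u) (ι p) + _
    = constField (ι p) (mvfderiv (𝓡 3) (fun q ↦ tcoord (ι p) (W q)) p u) (ι p) + _
  rw [mvfderiv_congr e, h.self_of_nhds]

lemma diffAlongAt_smul {f : H → ℝ} {V : ∀ p : H, TangentSpace (𝓡 4) (ι p)} {p : H}
    (hf : MDifferentiableAt (𝓡 3) 𝓘(ℝ, ℝ) f p) (hV : DiffAlongAt 3 ι V p) :
    DiffAlongAt 3 ι (fun q ↦ f q • V q) p := by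
  rw [diffAlongAt_iff] at hV ⊢
  refine ⟨hV.1, (hf.smul hV.2).congr_of_eventuallyEq ?_⟩
  filter_upwards [hV.1.continuousAt.eventually (eventually_mem_baseSet (ι p))] with q hq
  rw [tcoord_smul hq]; rfl

lemma diffAlongAt_add {V W : ∀ p : H, TangentSpace (𝓡 4) (ι p)} {p : H}
    (hV : DiffAlongAt 3 ι V p) (hW : DiffAlongAt 3 ι W p) :
    DiffAlongAt 3 ι (fun q ↦ V q + W q) p := by
  rw [diffAlongAt_iff] at hV hW ⊢
  refine ⟨hV.1, (hV.2.add hW.2).congr_of_eventuallyEq ?_⟩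
  filter_upwards [hV.1.continuousAt.eventually (eventually_mem_baseSet (ι p))] with q hq
  rw [tcoord_add hq]; rfl

lemma nablaAlong_smul {f : H → ℝ} {V : ∀ p : H, TangentSpace (𝓡 4) (ι p)} {p : H}
    (hf : MDifferentiableAt (𝓡 3) 𝓘(ℝ, ℝ) f p) (hV : DiffAlongAt 3 ι V p)
    (u : TangentSpace (𝓡 3) p) :
    nablaAlong g ι (fun q ↦ f q • V q) p u
      = mvfderiv (𝓡 3) f p u • V p + f p • nablaAlong g ι V p u := by
  refine ext_val (g := g) fun w ↦ ?_
  have hι := (diffAlongAt_iff.1 hV).1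
  rw [val_nablaAlong (diffAlongAt_smul hf hV)]
  simp only [map_add, map_smul, _root_.add_apply, _root_.smul_apply, smul_eq_mul]
  rw [val_nablaAlong hV, mvfderiv_mul_apply
    (h := fun q ↦ g.val (ι q) (V q) (FiberBundle.extend E4 w (ι q))) hf
    (g.diffAlongAt_pair hV (diffAlongAt_comp (fieldDiffAt_extend w) hι)),
    FiberBundle.extend_apply_self]
  ring

lemma nablaAlong_add {V W : ∀ p : H, TangentSpace (𝓡 4) (ι p)} {p : H}
    (hV : DiffAlongAt 3 ι V p) (hW : DiffAlongAt 3 ι W p)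
    (u : TangentSpace (𝓡 3) p) :
    nablaAlong g ι (fun q ↦ V q + W q) p u = nablaAlong g ι V p u + nablaAlong g ι W p u := by
  refine ext_val (g := g) fun w ↦ ?_
  have hι := (diffAlongAt_iff.1 hV).1
  have he := diffAlongAt_comp (fieldDiffAt_extend w) hι
  rw [val_nablaAlong (diffAlongAt_add hV hW)]
  simp only [map_add, _root_.add_apply]
  rw [val_nablaAlong hV, val_nablaAlong hW,
    mvfderiv_add_apply (g.diffAlongAt_pair hV he) (g.diffAlongAt_pair hW he)]
  ring

/-- Along `ι`, a vector field of the ambient space is differentiated by the connection. -/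
lemma nablaAlong_comp {Y : ∀ x : M, TangentSpace (𝓡 4) x} {p : H} (hY : FieldDiffAt Y (ι p))
    (hι : MDifferentiableAt (𝓡 3) (𝓡 4) ι p) (u : TangentSpace (𝓡 3) p) :
    nablaAlong g ι (fun q ↦ Y (ι q)) p u = g.nabla Y (ι p) (push ι p u) := by
  refine ext_val (g := g) fun w ↦ ?_
  have hw := fieldDiffAt_extend w
  have h := mvfderiv_comp_mfderiv (mdiff_pair (g := g) hY hw) hι u
  have h' := val_nabla_right (g := g) hY hw (push ι p u)
  rw [val_nablaAlong (diffAlongAt_comp hY hι)]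
  rw [FiberBundle.extend_apply_self] at h'
  have h'' : mvfderiv (𝓡 3) (fun q ↦ g.val (ι q) (Y (ι q)) (FiberBundle.extend E4 w (ι q))) p u
    = mvfderiv (𝓡 4) (g.pair Y (FiberBundle.extend E4 w)) (ι p) (push ι p u) := h
  linarith

/-- Differentiability is part of the conclusion because the induction step needs it for the partial
sum. -/
lemma nablaAlong_sum {κ : Type*} (s : Finset κ) {f : κ → H → ℝ}
    {Y : κ → ∀ x : M, TangentSpace (𝓡 4) x} {p : H} (hι : MDifferentiableAt (𝓡 3) (𝓡 4) ι p)
    (hf : ∀ i, MDifferentiableAt (𝓡 3) 𝓘(ℝ, ℝ) (f i) p) (hY : ∀ i, FieldDiffAt (Y i) (ι p))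
    (u : TangentSpace (𝓡 3) p) :
    DiffAlongAt 3 ι (fun q ↦ ∑ i ∈ s, f i q • Y i (ι q)) p ∧
    nablaAlong g ι (fun q ↦ ∑ i ∈ s, f i q • Y i (ι q)) p u
      = ∑ i ∈ s, (mvfderiv (𝓡 3) (f i) p u • Y i (ι p)
        + f i p • g.nabla (Y i) (ι p) (push ι p u)) := by
  classical
  induction s using Finset.induction_on with
  | empty =>
    have h0 : (fun q : H ↦ (∑ i ∈ (∅ : Finset κ), f i q • Y i (ι q) : TangentSpace (𝓡 4) (ι q)))
        = fun q ↦ (0 : ℝ) • FiberBundle.extend E4 (0 : TangentSpace (𝓡 4) (ι p)) (ι q) := by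
      funext q; simp
    have hd := diffAlongAt_comp (fieldDiffAt_extend (0 : TangentSpace (𝓡 4) (ι p))) hι
    have hc : MDifferentiableAt (𝓡 3) 𝓘(ℝ, ℝ) (fun _ : H ↦ (0 : ℝ)) p := mdifferentiableAt_const
    rw [h0]
    refine ⟨diffAlongAt_smul hc hd, ?_⟩
    rw [nablaAlong_smul hc hd, mvfderiv_const]
    simp
  | insert i s hi ih =>
    have hd := diffAlongAt_smul (hf i) (diffAlongAt_comp (hY i) hι)
    simp only [Finset.sum_insert hi]
    refine ⟨diffAlongAt_add hd ih.1, ?_⟩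
    rw [nablaAlong_add hd ih.1, ih.2, nablaAlong_smul (hf i) (diffAlongAt_comp (hY i) hι),
      nablaAlong_comp (hY i) hι]

omit [ChartedSpace E3 H] in
lemma eventually_nabla_eq_sum_frame {V : ∀ p : H, TangentSpace (𝓡 4) (ι p)} {p : H}
    (hι : ContinuousAt ι p) (Y : ∀ x : M, TangentSpace (𝓡 4) x) :
    ∀ᶠ q in 𝓝 p, g.nabla Y (ι q) (V q)
      = ∑ i, tcoord (ι p) (V q) i • g.nabla Y (ι q) (frame (ι p) i (ι q)) := by
  filter_upwards [eventually_eq_sum_frame hι V] with q hq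
  conv_lhs => rw [hq]
  simp only [map_sum, map_smul]

/-- Leibniz rule for the endomorphism field `∇Y` along `ι`. -/
lemma nablaAlong_nabla {V : ∀ p : H, TangentSpace (𝓡 4) (ι p)} {p : H}
    {Y : ∀ x : M, TangentSpace (𝓡 4) x} (hY : FieldSmoothAt Y (ι p))
    (hV : DiffAlongAt 3 ι V p) (u : TangentSpace (𝓡 3) p) :
    nablaAlong g ι (fun q ↦ g.nabla Y (ι q) (V q)) p u
      = g.hess Y (ι p) (push ι p u) (V p) + g.nabla Y (ι p) (nablaAlong g ι V p u) := by
  have hι := (diffAlongAt_iff.1 hV).1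
  -- Expanding `V` in the frame turns `∇_V Y` into a combination of restrictions of ambient fields,
  -- to which the sum rule applies.
  rw [nablaAlong_congr (eventually_nabla_eq_sum_frame hι.continuousAt Y),
    (nablaAlong_sum (g := g) Finset.univ hι (tcoord_diffAt hV)
    (fun i ↦ diffAt_of_smoothAt (smoothAt_nabla (g := g) (smoothAt_frame (ι p) i) hY)) u).2,
    nablaAlong_eq_sum hV]
  have h1 : g.hess Y (ι p) (push ι p u) (V p) = ∑ i, tcoord (ι p) (V p) i
      • g.hess Y (ι p) (push ι p u) (frame (ι p) i (ι p)) := by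
    change hessLin hY (push ι p u) (V p) = _
    conv_lhs => rw [eq_sum_frame (ι p) (V p)]
    simp only [map_sum, map_smul]
    rfl
  rw [h1, map_sum, ← Finset.sum_add_distrib]
  refine Finset.sum_congr rfl fun i _ ↦ ?_
  simp only [hess, extend_frame, map_add, map_smul, smul_sub]
  abel

lemma smoothAlongAt_comp {Y : ∀ x : M, TangentSpace (𝓡 4) x} {p : H} (hY : FieldSmoothAt Y (ι p))
    (hι : ContMDiffAt (𝓡 3) (𝓡 4) ∞ ι p) : SmoothAlongAt 3 ι (fun q ↦ Y (ι q)) p :=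
  ContMDiffAt.comp p hY hι

lemma tcoord_smoothAt {V : ∀ p : H, TangentSpace (𝓡 4) (ι p)} {p : H}
    (hV : SmoothAlongAt 3 ι V p) (i : Fin 4) :
    ContMDiffAt (𝓡 3) 𝓘(ℝ, ℝ) ∞ (fun q ↦ tcoord (ι p) (V q) i) p :=
  (EuclideanSpace.proj i : E4 →L[ℝ] ℝ).contMDiff.contMDiffAt.comp p (smoothAlongAt_iff.1 hV).2

lemma diffAlongAt_of_smoothAlongAt {V : ∀ p : H, TangentSpace (𝓡 4) (ι p)} {p : H}
    (hV : SmoothAlongAt 3 ι V p) : DiffAlongAt 3 ι V p :=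
  ContMDiffAt.mdifferentiableAt hV (by simp)

lemma smoothAlongAt_nabla {V : ∀ p : H, TangentSpace (𝓡 4) (ι p)} {p : H}
    {Y : ∀ x : M, TangentSpace (𝓡 4) x} (hY : FieldSmoothAt Y (ι p))
    (hV : SmoothAlongAt 3 ι V p) : SmoothAlongAt 3 ι (fun q ↦ g.nabla Y (ι q) (V q)) p := by
  have hι := (smoothAlongAt_iff.1 hV).1
  refine g.smoothAlongAt_of_pair hι fun c ↦ ?_
  have hs : ContMDiffAt (𝓡 3) 𝓘(ℝ, ℝ) ∞ (fun q ↦ ∑ i, tcoord (ι p) (V q) i *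
      g.val (ι q) (g.nabla Y (ι q) (frame (ι p) i (ι q))) (constField (ι p) c (ι q))) p := by
    refine ContMDiffAt.sum fun i _ ↦ (tcoord_smoothAt hV i).mul ?_
    exact g.smoothAlongAt_pair
      (smoothAlongAt_comp (smoothAt_nabla (g := g) (smoothAt_frame (ι p) i) hY) hι)
      (smoothAlongAt_comp (smoothAt_constField (ι p) c) hι)
  refine hs.congr_of_eventuallyEq ?_
  filter_upwards [eventually_nabla_eq_sum_frame hι.continuousAt Y (V := V)] with q hq
  rw [hq]
  simp only [map_sum, map_smul, _root_.sum_apply, _root_.smul_apply, smul_eq_mul]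

end LorentzMetric

/-! ### Torsion and curvature of the connection along the hypersurface -/

namespace LorentzMetric

open VectorField

section

variable {M : Type*} [TopologicalSpace M] [ChartedSpace E4 M] [IsManifold (𝓡 4) ∞ M]

/-- Bundle coordinates are derivatives of the chart, so the frame fields are coordinate fields; this
is what makes them commute. -/
lemma tcoord_eq_mvfderiv {x₀ x : M}
    (hx : x ∈ (trivializationAt E4 (TangentSpace (𝓡 4) : M → Type _) x₀).baseSet)
    (v : TangentSpace (𝓡 4) x) :
    tcoord x₀ v = mvfderiv (𝓡 4) (extChartAt (𝓡 4) x₀) x v := by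
  have hx' : x ∈ (chartAt E4 x₀).source := by
    simpa using hx
  have h := TangentBundle.continuousLinearMapAt_trivializationAt (I := 𝓡 4) hx'
  have h2 := congrArg (fun A : TangentSpace (𝓡 4) x →L[ℝ] E4 ↦ A v) h
  refine Eq.trans ?_ h2
  exact (Bundle.Trivialization.continuousLinearMapAt_apply_of_mem ℝ _ hx v).symm

/-- Coordinate vector fields commute. -/
lemma mlieBracket_extend (x : M) (a b : TangentSpace (𝓡 4) x) :
    mlieBracket (𝓡 4) (FiberBundle.extend E4 a) (FiberBundle.extend E4 b) x = 0 := by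
  have hc : ContMDiffAt (𝓡 4) 𝓘(ℝ, E4) ∞ (extChartAt (𝓡 4) x) x := contMDiffAt_extChartAt
  have ha := fieldSmoothAt_extend a
  have hb := fieldSmoothAt_extend b
  have h := mvfderiv_mlieBracket (hc.of_le ENat.LEInfty.out) (diffAt_of_smoothAt ha)
    (diffAt_of_smoothAt hb) ((contMDiffAt_mvfderiv_apply hc ha).mdifferentiableAt (by simp))
    ((contMDiffAt_mvfderiv_apply hc hb).mdifferentiableAt (by simp))
  -- The derivative of the chart along an extension is locally constant, so the commutator formula
  -- annihilates every coordinate of the bracket.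
  have e : ∀ c : TangentSpace (𝓡 4) x,
      (fun y ↦ mvfderiv (𝓡 4) (extChartAt (𝓡 4) x) y (FiberBundle.extend E4 c y)) =ᶠ[𝓝 x]
        fun _ ↦ tcoord x c := by
    intro c
    filter_upwards [eventually_mem_baseSet x] with y hy
    rw [← tcoord_eq_mvfderiv hy, extend_eq_constField, tcoord_constField hy]
  rw [mvfderiv_congr (e a), mvfderiv_congr (e b), mvfderiv_const, mvfderiv_const,
    ← tcoord_eq_mvfderiv (mem_baseSet_self x)] at h
  rw [← constField_tcoord (mem_baseSet_self x) (mlieBracket (𝓡 4) _ _ x), h]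
  simp [constField_zero]

end

variable {M : Type*} [TopologicalSpace M] [ChartedSpace E4 M] [IsManifold (𝓡 4) ∞ M]
  {H : Type*} [TopologicalSpace H] [ChartedSpace E3 H] [IsManifold (𝓡 3) ∞ H]
  {g : LorentzMetric M} {ι : H → M}

/-- Smoothness at `p` of a vector field on the hypersurface. -/
abbrev HSmoothAt (X : ∀ p : H, TangentSpace (𝓡 3) p) (p : H) : Prop :=
  ContMDiffAt (𝓡 3) ((𝓡 3).prod 𝓘(ℝ, E3)) ∞
    (fun q ↦ Bundle.TotalSpace.mk' E3 (E := (TangentSpace (𝓡 3) : H → Type _)) q (X q)) p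

lemma smoothAlongAt_push {X : ∀ p : H, TangentSpace (𝓡 3) p} {p : H}
    (hι : ContMDiffAt (𝓡 3) (𝓡 4) ∞ ι p) (hX : HSmoothAt X p) :
    SmoothAlongAt 3 ι (fun q ↦ push ι q (X q)) p :=
  contMDiffAt_mfderiv_apply hι hX

lemma hDiffAt {X : ∀ p : H, TangentSpace (𝓡 3) p} {p : H} (hX : HSmoothAt X p) :
    MDifferentiableAt (𝓡 3) ((𝓡 3).prod 𝓘(ℝ, E3))
      (fun q ↦ Bundle.TotalSpace.mk' E3 (E := (TangentSpace (𝓡 3) : H → Type _)) q (X q)) p :=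
  ContMDiffAt.mdifferentiableAt hX (by simp)

lemma mvfderiv_mlieBracket_of_smooth {F : Type*} [NormedAddCommGroup F] [NormedSpace ℝ F]
    {h : H → F} {p : H} {X Y : ∀ p : H, TangentSpace (𝓡 3) p}
    (hh : ContMDiffAt (𝓡 3) 𝓘(ℝ, F) ∞ h p) (hX : HSmoothAt X p) (hY : HSmoothAt Y p) :
    mvfderiv (𝓡 3) h p (mlieBracket (𝓡 3) X Y p)
      = mvfderiv (𝓡 3) (fun q ↦ mvfderiv (𝓡 3) h q (Y q)) p (X p)
        - mvfderiv (𝓡 3) (fun q ↦ mvfderiv (𝓡 3) h q (X q)) p (Y p) :=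
  mvfderiv_mlieBracket (hh.of_le ENat.LEInfty.out) (hDiffAt hX) (hDiffAt hY)
    ((contMDiffAt_mvfderiv_apply hh hX).mdifferentiableAt (by simp))
    ((contMDiffAt_mvfderiv_apply hh hY).mdifferentiableAt (by simp))

lemma eventually_diffAlongAt {V : ∀ p : H, TangentSpace (𝓡 4) (ι p)} {p : H}
    (hV : SmoothAlongAt 3 ι V p) : ∀ᶠ q in 𝓝 p, DiffAlongAt 3 ι V q := by
  have h1 := ContMDiffAt.of_le (m := 1) hV (by simp)
  filter_upwards [(contMDiffAt_iff_contMDiffAt_nhds (by decide)).1 h1] with y hy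
  exact ContMDiffAt.mdifferentiableAt hy (by decide)

/-- The connection along `ι` is torsion-free. -/
lemma nablaAlong_push_sub {X Y : ∀ p : H, TangentSpace (𝓡 3) p} {p : H}
    (hι : ContMDiffAt (𝓡 3) (𝓡 4) ∞ ι p) (hX : HSmoothAt X p) (hY : HSmoothAt Y p) :
    nablaAlong g ι (fun q ↦ push ι q (Y q)) p (X p)
      - nablaAlong g ι (fun q ↦ push ι q (X q)) p (Y p)
      = push ι p (mlieBracket (𝓡 3) X Y p) := by
  have hc : ContMDiffAt (𝓡 4) 𝓘(ℝ, E4) ∞ (extChartAt (𝓡 4) (ι p)) (ι p) := contMDiffAt_extChartAt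
  -- For the vector-valued function chart after `ι`, the commutator formula gives the
  -- coordinate-derivative part of the torsion identity.
  have hcι : ContMDiffAt (𝓡 3) 𝓘(ℝ, E4) ∞ (extChartAt (𝓡 4) (ι p) ∘ ι) p := hc.comp p hι
  have hB := mvfderiv_mlieBracket_of_smooth hcι hX hY
  have hιd : ∀ᶠ q in 𝓝 p, MDifferentiableAt (𝓡 3) (𝓡 4) ι q := by
    filter_upwards [eventually_diffAlongAt (smoothAlongAt_push hι hX)] with q hq
      using (diffAlongAt_iff.1 hq).1
  have hb : ∀ᶠ q in 𝓝 p, ι q ∈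
      (trivializationAt E4 (TangentSpace (𝓡 4) : M → Type _) (ι p)).baseSet :=
    hι.continuousAt.eventually (eventually_mem_baseSet (ι p))
  have pt : ∀ q, MDifferentiableAt (𝓡 3) (𝓡 4) ι q → ι q ∈
      (trivializationAt E4 (TangentSpace (𝓡 4) : M → Type _) (ι p)).baseSet →
      ∀ w : TangentSpace (𝓡 3) q,
      mvfderiv (𝓡 3) (extChartAt (𝓡 4) (ι p) ∘ ι) q w = tcoord (ι p) (push ι q w) := by
    intro q h1 h2 w
    rw [tcoord_eq_mvfderiv h2]
    refine mvfderiv_comp_mfderiv ?_ h1 w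
    exact mdifferentiableAt_extChartAt (by simpa using h2)
  have e : ∀ Z : ∀ p : H, TangentSpace (𝓡 3) p,
      (fun q ↦ mvfderiv (𝓡 3) (extChartAt (𝓡 4) (ι p) ∘ ι) q (Z q)) =ᶠ[𝓝 p]
        fun q ↦ tcoord (ι p) (push ι q (Z q)) := by
    intro Z
    filter_upwards [hιd, hb] with q h1 h2 using pt q h1 h2 (Z q)
  rw [mvfderiv_congr (e X), mvfderiv_congr (e Y), pt p hιd.self_of_nhds (mem_baseSet_self _)] at hB
  -- The remaining connection terms cancel, since the extensions commute.
  have ht := g.nabla_torsion_free (fieldDiffAt_extend (push ι p (X p)))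
    (fieldDiffAt_extend (push ι p (Y p)))
  rw [mlieBracket_extend] at ht
  simp only [FiberBundle.extend_apply_self] at ht
  have hs : ∀ c d : E4, constField (ι p) (c - d) (ι p)
      = constField (ι p) c (ι p) - constField (ι p) d (ι p) := by
    intro c d
    simp only [constField_eq_symmL (mem_baseSet_self (ι p)), map_sub]
  rw [← constField_tcoord (mem_baseSet_self (ι p)) (push ι p (mlieBracket (𝓡 3) X Y p)), hB, hs]
  change (constField (ι p) _ (ι p) + g.nabla _ (ι p) (push ι p (X p)))
    - (constField (ι p) _ (ι p) + g.nabla _ (ι p) (push ι p (Y p))) = _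
  rw [add_sub_add_comm, ht, add_zero]
  rfl

lemma smoothAlongAt_nablaAlong {V : ∀ p : H, TangentSpace (𝓡 4) (ι p)}
    {U : ∀ p : H, TangentSpace (𝓡 3) p} {p : H}
    (hV : SmoothAlongAt 3 ι V p) (hU : HSmoothAt U p) :
    SmoothAlongAt 3 ι (fun q ↦ nablaAlong g ι V q (U q)) p := by
  have hι := (smoothAlongAt_iff.1 hV).1
  refine g.smoothAlongAt_of_pair hι fun c ↦ ?_
  have hc := smoothAt_constField (ι p) c
  have h1 : ContMDiffAt (𝓡 3) 𝓘(ℝ, ℝ) ∞ (fun q ↦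
      mvfderiv (𝓡 3) (fun q ↦ g.val (ι q) (V q) (constField (ι p) c (ι q))) q (U q)
        - g.val (ι q) (V q) (g.nabla (constField (ι p) c) (ι q) (push ι q (U q)))) p :=
    (contMDiffAt_mvfderiv_apply (g.smoothAlongAt_pair hV (smoothAlongAt_comp hc hι)) hU).sub
      (g.smoothAlongAt_pair hV (smoothAlongAt_nabla hc (smoothAlongAt_push hι hU)))
  refine h1.congr_of_eventuallyEq ?_
  filter_upwards [eventually_diffAlongAt hV,
    hι.continuousAt.eventually (eventually_diffAt_of_smoothAt hc)] with q h2 h3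
  have hιq := (diffAlongAt_iff.1 h2).1
  have := mvfderiv_val (g := g) h2 (diffAlongAt_comp h3 hιq) (U q)
  rw [nablaAlong_comp h3 hιq] at this
  linarith

/-- The curvature of the connection along `ι` is the pull-back of the curvature. -/
lemma nablaAlong_commutator {V : ∀ p : H, TangentSpace (𝓡 4) (ι p)}
    {X U : ∀ p : H, TangentSpace (𝓡 3) p} {p : H} (hV : SmoothAlongAt 3 ι V p)
    (hX : HSmoothAt X p) (hU : HSmoothAt U p) :
    nablaAlong g ι (fun q ↦ nablaAlong g ι V q (U q)) p (X p)
      - nablaAlong g ι (fun q ↦ nablaAlong g ι V q (X q)) p (U p)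
      - nablaAlong g ι V p (mlieBracket (𝓡 3) X U p)
      = g.curvature (ι p) (push ι p (X p)) (push ι p (U p)) (V p) := by
  refine ext_val (g := g) fun w ↦ ?_
  have hι := (smoothAlongAt_iff.1 hV).1
  have hιd := hι.mdifferentiableAt (by simp)
  have hw := fieldSmoothAt_extend w
  set W := FiberBundle.extend E4 w with hW
  have hWp : W (ι p) = w := FiberBundle.extend_apply_self E4 w
  have hWι := smoothAlongAt_comp hw hι
  -- The function `g(V, W)` is differentiated twice, with `W` an ambient test field. After
  -- antisymmetrization the mixed terms cancel and the Hessian of `W` leaves a curvature, which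
  -- skewness moves to `V`.
  have key : ∀ {A B : ∀ p : H, TangentSpace (𝓡 3) p}, HSmoothAt A p → HSmoothAt B p →
      mvfderiv (𝓡 3) (fun q ↦ mvfderiv (𝓡 3) (fun q ↦ g.val (ι q) (V q) (W (ι q))) q (B q)) p (A p)
        = g.val (ι p) (nablaAlong g ι (fun q ↦ nablaAlong g ι V q (B q)) p (A p)) w
          + g.val (ι p) (nablaAlong g ι V p (B p)) (g.nabla W (ι p) (push ι p (A p)))
          + (g.val (ι p) (nablaAlong g ι V p (A p)) (g.nabla W (ι p) (push ι p (B p)))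
          + g.val (ι p) (V p) (g.hess W (ι p) (push ι p (A p)) (push ι p (B p))
            + g.nabla W (ι p) (nablaAlong g ι (fun q ↦ push ι q (B q)) p (A p)))) := by
    intro A B hA hB
    have s1 := smoothAlongAt_nablaAlong (g := g) hV hB
    have s2 := smoothAlongAt_nabla (g := g) hw (smoothAlongAt_push hι hB)
    have e : (fun q ↦ mvfderiv (𝓡 3) (fun q ↦ g.val (ι q) (V q) (W (ι q))) q (B q)) =ᶠ[𝓝 p]
        fun q ↦ g.val (ι q) (nablaAlong g ι V q (B q)) (W (ι q))
          + g.val (ι q) (V q) (g.nabla W (ι q) (push ι q (B q))) := by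
      filter_upwards [eventually_diffAlongAt hV,
        hι.continuousAt.eventually (eventually_diffAt_of_smoothAt hw)] with q h2 h3
      have hιq := (diffAlongAt_iff.1 h2).1
      rw [mvfderiv_val h2 (diffAlongAt_comp h3 hιq), nablaAlong_comp h3 hιq]
    have d1 := diffAlongAt_of_smoothAlongAt s1
    have d2 := diffAlongAt_of_smoothAlongAt s2
    have dW := diffAlongAt_of_smoothAlongAt hWι
    have dV := diffAlongAt_of_smoothAlongAt hV
    rw [mvfderiv_congr e, mvfderiv_add_apply (g.diffAlongAt_pair d1 dW) (g.diffAlongAt_pair dV d2),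
      mvfderiv_val d1 dW, mvfderiv_val dV d2, nablaAlong_comp (diffAt_of_smoothAt hw) hιd,
      nablaAlong_nabla hw (diffAlongAt_of_smoothAlongAt (smoothAlongAt_push hι hB)), hWp]
  have hB := mvfderiv_mlieBracket_of_smooth (g.smoothAlongAt_pair hV hWι) hX hU
  rw [key hX hU, key hU hX, mvfderiv_val (diffAlongAt_of_smoothAlongAt hV)
    (diffAlongAt_of_smoothAlongAt hWι), nablaAlong_comp (diffAt_of_smoothAt hw) hιd,
    ← nablaAlong_push_sub (g := g) hι hX hU, hWp] at hB
  have hR := congrArg (g.val (ι p) (V p)) (hess_sub_hess (g := g) hw (push ι p (X p))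
    (push ι p (U p)))
  rw [val_curvature, ← hWp]
  rw [hWp] at hR ⊢
  simp only [map_sub, map_add, _root_.sub_apply] at hB hR ⊢
  linarith

end LorentzMetric

/-! ### Linear algebra of the null pair and projection to the leaves -/

namespace GeodesicFoliation

open LorentzMetric

variable {M : Type*} [TopologicalSpace M] [ChartedSpace E4 M] [IsManifold (𝓡 4) ∞ M]
  {H : Type*} [TopologicalSpace H] [ChartedSpace E3 H] [IsManifold (𝓡 3) ∞ H]
  {g : LorentzMetric M} {ι : H → M} (S : GeodesicFoliation g ι)

lemma val_LM_push (p : H) (w : TangentSpace (𝓡 3) p) :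
    g.val (ι p) (S.LM p) (push ι p w) = 0 := S.L_normal p w

lemma val_push_LM (p : H) (w : TangentSpace (𝓡 3) p) :
    g.val (ι p) (push ι p w) (S.LM p) = 0 := by
  rw [g.symm, val_LM_push]

lemma val_LM_Lbar (p : H) : g.val (ι p) (S.LM p) (S.Lbar p) = -1 := S.normalized p

lemma val_Lbar_LM (p : H) : g.val (ι p) (S.Lbar p) (S.LM p) = -1 := by
  rw [g.symm, val_LM_Lbar]

/-- Subtracting `dv(w) L` from `w` gives a vector tangent to the leaf, which `Lbar` annihilates; the
rest is the normalization. -/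
lemma val_Lbar_push (p : H) (w : TangentSpace (𝓡 3) p) :
    g.val (ι p) (S.Lbar p) (push ι p w) = - mvfderiv (𝓡 3) S.v p w := by
  have h := S.Lbar_normal p (w - mvfderiv (𝓡 3) S.v p w • S.L p) (by simp [S.L_v])
  have h' := S.val_Lbar_LM p
  rw [LM] at h'
  rw [map_sub, map_smul, map_sub, map_smul, h', smul_eq_mul] at h
  linarith

lemma val_push_Lbar (p : H) (w : TangentSpace (𝓡 3) p) :
    g.val (ι p) (push ι p w) (S.Lbar p) = - mvfderiv (𝓡 3) S.v p w := by
  rw [g.symm, val_Lbar_push]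

/-- `Lbar` is transverse to the hypersurface, because `L` annihilates the tangent space but not
`Lbar`; the dimensions `3 + 1 = 4` then suffice. -/
lemma exists_eq_push_add {p : H} (hι : Function.Injective (push ι p))
    (z : TangentSpace (𝓡 4) (ι p)) :
    ∃ (w : TangentSpace (𝓡 3) p) (t : ℝ), z = push ι p w + t • S.Lbar p := by
  let A : TangentSpace (𝓡 3) p × ℝ →ₗ[ℝ] TangentSpace (𝓡 4) (ι p) :=
    (push ι p).toLinearMap.coprod (LinearMap.toSpanSingleton ℝ _ (S.Lbar p))
  have hA : ∀ w t, A (w, t) = push ι p w + t • S.Lbar p := fun w t ↦ by simp [A]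
  have hinj : Function.Injective A := by
    rw [← LinearMap.ker_eq_bot, LinearMap.ker_eq_bot']
    rintro ⟨w, t⟩ h
    rw [hA] at h
    have ht : t = 0 := by
      have := congrArg (g.val (ι p) (S.LM p)) h
      rw [map_add, map_smul, val_LM_push, val_LM_Lbar, map_zero] at this
      simpa using this
    subst ht
    rw [zero_smul, add_zero] at h
    rw [hι (h.trans (map_zero _).symm)]
    rfl
  have : FiniteDimensional ℝ (TangentSpace (𝓡 3) p) :=
    inferInstanceAs (FiniteDimensional ℝ E3)
  have hd : Module.finrank ℝ (TangentSpace (𝓡 3) p × ℝ)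
      = Module.finrank ℝ (TangentSpace (𝓡 4) (ι p)) := by
    have h3 : Module.finrank ℝ (TangentSpace (𝓡 3) p) = 3 := finrank_euclideanSpace_fin (𝕜 := ℝ)
    have h4 : Module.finrank ℝ (TangentSpace (𝓡 4) (ι p)) = 4 :=
      finrank_euclideanSpace_fin (𝕜 := ℝ)
    rw [Module.finrank_prod, h3, h4, Module.finrank_self]
  obtain ⟨⟨w, t⟩, h⟩ :=
    (LinearMap.injective_iff_surjective_of_finrank_eq_finrank hd).1 hinj z
  exact ⟨w, t, by rw [← hA, h]⟩

/-- A normal vector of a null hypersurface is a multiple of `L`. -/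
lemma eq_smul_LM {p : H} (hι : Function.Injective (push ι p)) {z : TangentSpace (𝓡 4) (ι p)}
    (hz : ∀ w, g.val (ι p) z (push ι p w) = 0) :
    z = (- g.val (ι p) z (S.Lbar p)) • S.LM p := by
  rw [← sub_eq_zero]
  refine g.nondegenerate (ι p) _ fun y ↦ ?_
  obtain ⟨w, t, rfl⟩ := S.exists_eq_push_add hι y
  simp only [map_sub, map_smul, map_add, _root_.sub_apply, _root_.smul_apply, smul_eq_mul,
    val_LM_push, val_LM_Lbar, hz]
  ring

/-- A vector orthogonal to `L` is tangent to the null hypersurface. -/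
lemma exists_eq_push {p : H} (hι : Function.Injective (push ι p)) {z : TangentSpace (𝓡 4) (ι p)}
    (hz : g.val (ι p) (S.LM p) z = 0) : ∃ w : TangentSpace (𝓡 3) p, z = push ι p w := by
  obtain ⟨w, t, rfl⟩ := S.exists_eq_push_add hι z
  rw [map_add, map_smul, val_LM_push, val_LM_Lbar, zero_add, smul_eq_mul, mul_neg_one,
    neg_eq_zero] at hz
  exact ⟨w, by rw [hz, zero_smul, add_zero]⟩

/-- The vector to which `invFun` is applied lies in the range of the injective `push ι p`, so no
default value intervenes. -/
lemma proj_push {p : H} (hι : Function.Injective (push ι p)) (w : TangentSpace (𝓡 3) p) :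
    S.proj p (push ι p w) = w - mvfderiv (𝓡 3) S.v p w • S.L p := by
  have h : push ι p w + g.val (ι p) (push ι p w) (S.Lbar p) • S.LM p
      + g.val (ι p) (push ι p w) (S.LM p) • S.Lbar p
      = push ι p (w - mvfderiv (𝓡 3) S.v p w • S.L p) := by
    rw [val_push_Lbar, val_push_LM, zero_smul, add_zero, map_sub, map_smul, neg_smul,
      ← sub_eq_add_neg, LM]
  rw [proj, h]
  exact Function.leftInverse_invFun hι _

lemma proj_push_of_tangent {p : H} (hι : Function.Injective (push ι p))
    {w : TangentSpace (𝓡 3) p} (hw : S.Tangent p w) : S.proj p (push ι p w) = w := by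
  have hw' : mvfderiv (𝓡 3) S.v p w = 0 := hw
  rw [S.proj_push hι, hw', zero_smul, sub_zero]

/-- The reason why the projected Lie and covariant derivatives along `L` agree: their arguments
differ by a multiple of `L`. -/
lemma proj_push_add_smul {p : H} (hι : Function.Injective (push ι p))
    (w : TangentSpace (𝓡 3) p) (c : ℝ) :
    S.proj p (push ι p w + c • S.LM p) = S.proj p (push ι p w) := by
  have h : push ι p w + c • S.LM p = push ι p (w + c • S.L p) := by
    rw [map_add, map_smul, LM]
  rw [h, S.proj_push hι, S.proj_push hι, map_add, map_smul, S.L_v]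
  module

end GeodesicFoliation

/-! ### Linearity of the derivative in its direction -/

namespace LorentzMetric

variable {M : Type*} [TopologicalSpace M] [ChartedSpace E4 M] [IsManifold (𝓡 4) ∞ M]
  {H : Type*} [TopologicalSpace H] [ChartedSpace E3 H]
  {g : LorentzMetric M} {ι : H → M}

lemma hSmoothAt_extend [IsManifold (𝓡 3) ∞ H] {p : H} (u : TangentSpace (𝓡 3) p) :
    HSmoothAt (FiberBundle.extend E3 u) p :=
  FiberBundle.contMDiffAt_extend (𝓡 3) E3 (k := ∞) u

lemma nablaAlong_dir_add {V : ∀ p : H, TangentSpace (𝓡 4) (ι p)} {p : H}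
    (hV : DiffAlongAt 3 ι V p) (u w : TangentSpace (𝓡 3) p) :
    nablaAlong g ι V p (u + w) = nablaAlong g ι V p u + nablaAlong g ι V p w := by
  refine ext_val (g := g) fun y ↦ ?_
  rw [map_add, _root_.add_apply]
  simp only [val_nablaAlong hV, map_add]
  ring

lemma nablaAlong_dir_smul {V : ∀ p : H, TangentSpace (𝓡 4) (ι p)} {p : H}
    (hV : DiffAlongAt 3 ι V p) (c : ℝ) (u : TangentSpace (𝓡 3) p) :
    nablaAlong g ι V p (c • u) = c • nablaAlong g ι V p u := by
  refine ext_val (g := g) fun y ↦ ?_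
  rw [map_smul, _root_.smul_apply]
  simp only [val_nablaAlong hV, map_smul, smul_eq_mul]
  ring

end LorentzMetric

/-! ### The horizon is totally geodesic; surface gravity -/

namespace GeodesicFoliation

open LorentzMetric

variable {M : Type*} [TopologicalSpace M] [ChartedSpace E4 M] [IsManifold (𝓡 4) ∞ M]
  {H : Type*} [TopologicalSpace H] [ChartedSpace E3 H] [IsManifold (𝓡 3) ∞ H]
  {g : LorentzMetric M} {ι : H → M} (S : GeodesicFoliation g ι)

lemma LM_ne_zero (p : H) : S.LM p ≠ 0 := by
  intro h
  have := S.val_LM_Lbar p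
  simp [h] at this

lemma smoothAlongAt_LM (hN : IsNullHypersurface g ι) (p : H) : SmoothAlongAt 3 ι S.LM p :=
  smoothAlongAt_push (hN.smooth p) (S.L_smooth p)

lemma diffAlongAt_LM (hN : IsNullHypersurface g ι) (p : H) : DiffAlongAt 3 ι S.LM p :=
  diffAlongAt_of_smoothAlongAt (S.smoothAlongAt_LM hN p)

lemma diffAlongAt_Lbar (p : H) : DiffAlongAt 3 ι S.Lbar p :=
  diffAlongAt_of_smoothAlongAt (S.Lbar_smooth p)

lemma nablaAlong_LM_L (p : H) : nablaAlong g ι S.LM p (S.L p) = 0 := S.geodesic p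

/-- The connection form `u ↦ g(∇_u L, Lbar)` of the foliation. -/
def connForm (p : H) (u : TangentSpace (𝓡 3) p) : ℝ :=
  g.val (ι p) (nablaAlong g ι S.LM p u) (S.Lbar p)

lemma connForm_L (p : H) : S.connForm p (S.L p) = 0 := by
  simp [connForm, nablaAlong_LM_L]

lemma connForm_add (hN : IsNullHypersurface g ι) {p : H} (u w : TangentSpace (𝓡 3) p) :
    S.connForm p (u + w) = S.connForm p u + S.connForm p w := by
  simp [connForm, nablaAlong_dir_add (S.diffAlongAt_LM hN p)]

lemma connForm_smul (hN : IsNullHypersurface g ι) {p : H} (c : ℝ) (u : TangentSpace (𝓡 3) p) :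
    S.connForm p (c • u) = c * S.connForm p u := by
  simp [connForm, nablaAlong_dir_smul (S.diffAlongAt_LM hN p)]

/-- Being geodesic, `L` is in the kernel of the form, so only the leaf component of the direction
matters. -/
lemma connForm_sub_smul_L (hN : IsNullHypersurface g ι) {p : H} (u : TangentSpace (𝓡 3) p)
    (c : ℝ) : S.connForm p (u - c • S.L p) = S.connForm p u := by
  rw [sub_eq_add_neg, ← neg_smul, S.connForm_add hN, S.connForm_smul hN, connForm_L]
  ring

lemma val_nablaAlong_LM_eq_neg (hN : IsNullHypersurface g ι) {p : H}
    {W : ∀ p : H, TangentSpace (𝓡 3) p} (hW : HSmoothAt W p) (u : TangentSpace (𝓡 3) p) :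
    g.val (ι p) (nablaAlong g ι S.LM p u) (push ι p (W p))
      = - g.val (ι p) (S.LM p) (nablaAlong g ι (fun q ↦ push ι q (W q)) p u) := by
  have h := mvfderiv_val (g := g) (S.diffAlongAt_LM hN p)
    (diffAlongAt_of_smoothAlongAt (smoothAlongAt_push (hN.smooth p) hW)) u
  have h0 : (fun q ↦ g.val (ι q) (S.LM q) (push ι q (W q))) = fun _ ↦ (0 : ℝ) :=
    funext fun q ↦ S.val_LM_push q _
  rw [h0, mvfderiv_const] at h
  exact eq_neg_of_add_eq_zero_left h.symm

/-- The second fundamental form of a null hypersurface is symmetric. -/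
lemma val_nablaAlong_LM_comm (hN : IsNullHypersurface g ι) {p : H}
    (u w : TangentSpace (𝓡 3) p) :
    g.val (ι p) (nablaAlong g ι S.LM p u) (push ι p w)
      = g.val (ι p) (nablaAlong g ι S.LM p w) (push ι p u) := by
  have h1 := S.val_nablaAlong_LM_eq_neg hN (hSmoothAt_extend w) u
  have h2 := S.val_nablaAlong_LM_eq_neg hN (hSmoothAt_extend u) w
  have h3 := nablaAlong_push_sub (g := g) (hN.smooth p) (hSmoothAt_extend u) (hSmoothAt_extend w)
  have h4 := congrArg (g.val (ι p) (S.LM p)) h3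
  rw [val_LM_push, map_sub] at h4
  simp only [FiberBundle.extend_apply_self] at h1 h2 h4
  linarith

section Killing

variable {ξ : ∀ x : M, TangentSpace (𝓡 4) x} (hH : IsKillingHorizon g ι ξ)

variable (ξ) in
/-- The factor `f` in `ξ = f L`. -/
def factor (p : H) : ℝ := - g.val (ι p) (ξ (ι p)) (S.Lbar p)

include hH

lemma eq_factor_smul (p : H) : ξ (ι p) = S.factor ξ p • S.LM p :=
  S.eq_smul_LM (hH.hypersurface.immersion p) (hH.normal p)

lemma factor_ne_zero (p : H) : S.factor ξ p ≠ 0 := by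
  intro h
  have := S.eq_factor_smul hH p
  rw [h, zero_smul] at this
  exact hH.ne_zero p this

lemma contMDiffAt_factor (p : H) : ContMDiffAt (𝓡 3) 𝓘(ℝ, ℝ) ∞ (S.factor ξ) p :=
  (g.smoothAlongAt_pair (smoothAlongAt_comp (hH.killing.smoothAt (ι p))
    (hH.hypersurface.smooth p)) (S.Lbar_smooth p)).neg

lemma mdiff_factor (p : H) : MDifferentiableAt (𝓡 3) 𝓘(ℝ, ℝ) (S.factor ξ) p :=
  (S.contMDiffAt_factor hH p).mdifferentiableAt (by simp)

/-- The equality `ξ = f L` holds on the hypersurface only, so it is differentiated along `ι`, in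
tangential directions. -/
lemma nabla_killing_push_eq_add (p : H) (u : TangentSpace (𝓡 3) p) :
    g.nabla ξ (ι p) (push ι p u)
      = mvfderiv (𝓡 3) (S.factor ξ) p u • S.LM p + S.factor ξ p • nablaAlong g ι S.LM p u := by
  rw [← nablaAlong_comp (diffAt_of_smoothAt (hH.killing.smoothAt _))
      ((hH.hypersurface.smooth p).mdifferentiableAt (by simp)),
    ← nablaAlong_smul (S.mdiff_factor hH p) (S.diffAlongAt_LM hH.hypersurface p)]
  exact nablaAlong_congr (Filter.Eventually.of_forall fun q ↦ S.eq_factor_smul hH q) u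

/-- A Killing horizon is totally geodesic. -/
lemma val_nablaAlong_LM_push (p : H) (u w : TangentSpace (𝓡 3) p) :
    g.val (ι p) (nablaAlong g ι S.LM p u) (push ι p w) = 0 := by
  have hu := congrArg (fun z ↦ g.val (ι p) z (push ι p w)) (S.nabla_killing_push_eq_add hH p u)
  have hw := congrArg (fun z ↦ g.val (ι p) z (push ι p u)) (S.nabla_killing_push_eq_add hH p w)
  -- Skewness from the Killing equation meets the symmetry of the second fundamental form; what is
  -- both skew and symmetric is zero.
  have hk := hH.killing.val_nabla_swap (ι p) (push ι p u) (push ι p w)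
  rw [g.symm _ (push ι p u)] at hk
  simp only [map_add, map_smul, _root_.add_apply, _root_.smul_apply, smul_eq_mul,
    val_LM_push, mul_zero, zero_add] at hu hw
  rw [hu, hw, S.val_nablaAlong_LM_comm hH.hypersurface w u] at hk
  have : S.factor ξ p * g.val (ι p) (nablaAlong g ι S.LM p u) (push ι p w) = 0 := by linarith
  exact (mul_eq_zero.1 this).resolve_left (S.factor_ne_zero hH p)

/-- By total geodesy `∇_u L` is normal to the horizon, hence a multiple of `L`; its product with
`Lbar` gives the coefficient. -/
lemma nablaAlong_LM (p : H) (u : TangentSpace (𝓡 3) p) :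
    nablaAlong g ι S.LM p u = (- S.connForm p u) • S.LM p :=
  S.eq_smul_LM (hH.hypersurface.immersion p) (S.val_nablaAlong_LM_push hH p u)

lemma nabla_killing_push (p : H) (u : TangentSpace (𝓡 3) p) :
    g.nabla ξ (ι p) (push ι p u)
      = (mvfderiv (𝓡 3) (S.factor ξ) p u - S.factor ξ p * S.connForm p u) • S.LM p := by
  rw [S.nabla_killing_push_eq_add hH, S.nablaAlong_LM hH, smul_smul, ← add_smul]
  congr 1
  ring

lemma nabla_killing_LM (p : H) :
    g.nabla ξ (ι p) (S.LM p) = mvfderiv (𝓡 3) (S.factor ξ) p (S.L p) • S.LM p := by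
  have := S.nabla_killing_push hH p (S.L p)
  rwa [connForm_L, mul_zero, sub_zero] at this

variable {κ : H → ℝ} (hκ : ∀ p : H, g.nabla ξ (ι p) (ξ (ι p)) = κ p • ξ (ι p))

include hκ

/-- `∇_ξ ξ = f ∇_L ξ = f (L f) L`; comparison with `κ f L` allows cancelling `f`. -/
lemma surfaceGravity_eq (p : H) : κ p = mvfderiv (𝓡 3) (S.factor ξ) p (S.L p) := by
  have h := hκ p
  rw [S.eq_factor_smul hH p, map_smul, S.nabla_killing_LM hH, smul_smul, smul_smul, mul_comm] at h
  exact (mul_right_cancel₀ (S.factor_ne_zero hH p)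
    (smul_left_injective ℝ (S.LM_ne_zero p) h)).symm

-- Regularity of `κ` is not assumed: it follows from `κ = L f`.
include S in
lemma contMDiffAt_surfaceGravity (p : H) : ContMDiffAt (𝓡 3) 𝓘(ℝ, ℝ) ∞ κ p := by
  rw [funext (S.surfaceGravity_eq hH hκ)]
  exact contMDiffAt_mvfderiv_apply (S.contMDiffAt_factor hH p) (S.L_smooth p)

end Killing

end GeodesicFoliation

/-! ### Two curvature identities for repeated null directions -/

namespace LorentzMetric

variable {M : Type*} [TopologicalSpace M] [ChartedSpace E4 M] [IsManifold (𝓡 4) ∞ M]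
  {g : LorentzMetric M}

lemma riemann_smul_second (x : M) (r : ℝ) (a b c d : TangentSpace (𝓡 4) x) :
    g.riemann x a (r • b) c d = r * g.riemann x a b c d := by
  rw [g.riemann_swap_left x a (r • b), g.riemann_swap_left x a b]
  simp [riemann]

lemma riemann_self_left (x : M) (a c d : TangentSpace (𝓡 4) x) : g.riemann x a a c d = 0 := by
  have := g.riemann_swap_left x a a c d
  linarith

end LorentzMetric

/-! ### The induced metric, the gradient of surface gravity and the torsion -/

namespace GeodesicFoliation

open LorentzMetric VectorField

variable {M : Type*} [TopologicalSpace M] [ChartedSpace E4 M] [IsManifold (𝓡 4) ∞ M]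
  {H : Type*} [TopologicalSpace H] [ChartedSpace E3 H] [IsManifold (𝓡 3) ∞ H]
  {g : LorentzMetric M} {ι : H → M} (S : GeodesicFoliation g ι)
  {ξ : ∀ x : M, TangentSpace (𝓡 4) x} (hH : IsKillingHorizon g ι ξ)

include hH

lemma chi_eq_zero (p : H) (Z W : TangentSpace (𝓡 4) (ι p)) : S.chi p Z W = 0 :=
  S.val_nablaAlong_LM_push hH p _ _

/-- The projection changes a tangent vector by a multiple of `L`, which is orthogonal to the whole
tangent space of the horizon. -/
lemma gslash_push (p : H) (u w : TangentSpace (𝓡 3) p) :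
    S.gslash p (push ι p u) (push ι p w) = g.val (ι p) (push ι p u) (push ι p w) := by
  have h1 := S.val_LM_push p
  have h2 := S.val_push_LM p
  unfold LM at h1 h2
  rw [gslash, S.proj_push (hH.hypersurface.immersion p), S.proj_push (hH.hypersurface.immersion p)]
  simp [h1, h2]

/-- Vanishing torsion replaces `∇_L U` by `[L, U] + ∇_U L`, and `∇_U L` is parallel to `L`. -/
lemma nablaAlong_push_L {p : H} {U : ∀ p : H, TangentSpace (𝓡 3) p} (hU : HSmoothAt U p) :
    nablaAlong g ι (fun q ↦ push ι q (U q)) p (S.L p)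
      = push ι p (mlieBracket (𝓡 3) S.L U p) + (- S.connForm p (U p)) • S.LM p := by
  rw [← nablaAlong_push_sub (g := g) (hH.hypersurface.smooth p) (S.L_smooth p) hU,
    ← S.nablaAlong_LM hH]
  exact (sub_add_cancel _ _).symm

lemma proj_nablaAlong_push_L {p : H} {U : ∀ p : H, TangentSpace (𝓡 3) p} (hU : HSmoothAt U p) :
    S.proj p (nablaAlong g ι (fun q ↦ push ι q (U q)) p (S.L p))
      = S.proj p (push ι p (mlieBracket (𝓡 3) S.L U p)) := by
  rw [S.nablaAlong_push_L hH hU, S.proj_push_add_smul (hH.hypersurface.immersion p)]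

/-- By metric compatibility only the corrections `-ω(U) L` survive, and they are orthogonal to
tangent vectors. -/
lemma lie2_gslash (p : H) (u w : TangentSpace (𝓡 3) p) : S.lie2 S.gslash p u w = 0 := by
  have hu := hSmoothAt_extend u
  have hw := hSmoothAt_extend w
  have h := mvfderiv_val (g := g)
    (diffAlongAt_of_smoothAlongAt (smoothAlongAt_push (hH.hypersurface.smooth p) hu))
    (diffAlongAt_of_smoothAlongAt (smoothAlongAt_push (hH.hypersurface.smooth p) hw)) (S.L p)
  rw [lie2]
  simp only [S.gslash_push hH]
  rw [h, S.nablaAlong_push_L hH hu, S.nablaAlong_push_L hH hw]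
  simp [S.val_LM_push, S.val_push_LM]

lemma connForm_proj (p : H) (u : TangentSpace (𝓡 3) p) :
    S.connForm p (S.proj p (push ι p u)) = S.connForm p u := by
  rw [S.proj_push (hH.hypersurface.immersion p), S.connForm_sub_smul_L hH.hypersurface]

lemma zeta_push (p : H) (u : TangentSpace (𝓡 3) p) : S.zeta p (push ι p u) = S.connForm p u :=
  S.connForm_proj hH p u

lemma contMDiffAt_connForm {p : H} {U : ∀ p : H, TangentSpace (𝓡 3) p} (hU : HSmoothAt U p) :
    ContMDiffAt (𝓡 3) 𝓘(ℝ, ℝ) ∞ (fun q ↦ S.connForm q (U q)) p :=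
  g.smoothAlongAt_pair (smoothAlongAt_nablaAlong (S.smoothAlongAt_LM hH.hypersurface p) hU)
    (S.Lbar_smooth p)

/-- The Hessian is the curvature `R(L, ξ, ·, ·)`, and `ξ` is parallel to `L`. -/
lemma val_hess_LM_left (p : H) (b c : TangentSpace (𝓡 4) (ι p)) :
    g.val (ι p) (g.hess ξ (ι p) (S.LM p) b) c = 0 := by
  rw [hH.killing.val_hess, S.eq_factor_smul hH p, riemann_smul_second, riemann_self_left]
  simp

variable {κ : H → ℝ} (hκ : ∀ p : H, g.nabla ξ (ι p) (ξ (ι p)) = κ p • ξ (ι p))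

include hκ

-- Differentiate `∇_ξ ξ = κ ξ` along `u`. The terms `κ ∇_u ξ` and `∇_{∇_u ξ} ξ` cancel, because `∇_u
-- ξ` is a multiple of `L` and `∇_L ξ = κ L`.
include S in
lemma hess_push_killing (p : H) (u : TangentSpace (𝓡 3) p) :
    g.hess ξ (ι p) (push ι p u) (ξ (ι p)) = mvfderiv (𝓡 3) κ p u • ξ (ι p) := by
  have hs := hH.killing.smoothAt (ι p)
  have hι := (hH.hypersurface.smooth p).mdifferentiableAt (n := ∞) (by simp)
  have hd := diffAlongAt_comp (diffAt_of_smoothAt hs) hι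
  have h1 := nablaAlong_nabla (g := g) hs hd u
  have h2 := nablaAlong_smul (g := g)
    ((S.contMDiffAt_surfaceGravity hH hκ p).mdifferentiableAt (by simp)) hd u
  rw [nablaAlong_congr (Filter.Eventually.of_forall fun q ↦ hκ q), h2,
    nablaAlong_comp (diffAt_of_smoothAt hs) hι, S.nabla_killing_push hH, map_smul,
    S.nabla_killing_LM hH, ← S.surfaceGravity_eq hH hκ, smul_comm (κ p)] at h1
  exact (add_right_cancel h1).symm

/-- After cancelling one factor `f`, take the product with `Lbar`: one side is `-dκ(u)`, and the
Killing identity turns the other into curvature. -/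
lemma mvfderiv_surfaceGravity (p : H) (u : TangentSpace (𝓡 3) p) :
    mvfderiv (𝓡 3) κ p u
      = - S.factor ξ p * g.riemann (ι p) (push ι p u) (S.LM p) (S.Lbar p) (S.LM p) := by
  have hf := S.factor_ne_zero hH p
  have h1 := hH.killing.val_hess (ι p) (push ι p u) (S.LM p) (S.Lbar p)
  have h2 := S.hess_push_killing hH hκ p u
  rw [S.eq_factor_smul hH p, hess_smul_right (hH.killing.smoothAt _), smul_comm] at h2
  have h3 := congrArg (fun z ↦ g.val (ι p) z (S.Lbar p))
    (smul_right_injective (TangentSpace (𝓡 4) (ι p)) hf h2)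
  simp only [map_smul, _root_.smul_apply, S.val_LM_Lbar] at h3
  rw [h1, S.eq_factor_smul hH p, riemann_smul_second, riemann_swap_right, smul_eq_mul] at h3
  linarith

lemma mvfderiv_surfaceGravity_of_tangent (p : H) {u : TangentSpace (𝓡 3) p}
    (hu : S.Tangent p u) :
    mvfderiv (𝓡 3) κ p u = - S.factor ξ p * S.beta p (push ι p u) := by
  rw [S.mvfderiv_surfaceGravity hH hκ, beta,
    S.proj_push_of_tangent (hH.hypersurface.immersion p) hu]

/-- The Lie derivative of the connection form along `L`. -/
lemma factor_mul_lie_connForm {p : H} {U : ∀ p : H, TangentSpace (𝓡 3) p} (hU : HSmoothAt U p) :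
    S.factor ξ p * (mvfderiv (𝓡 3) (fun q ↦ S.connForm q (U q)) p (S.L p)
      - S.connForm p (mlieBracket (𝓡 3) S.L U p)) = mvfderiv (𝓡 3) κ p (U p) := by
  have hs := hH.killing.smoothAt (ι p)
  have hdU := diffAlongAt_of_smoothAlongAt (smoothAlongAt_push (hH.hypersurface.smooth p) hU)
  have hfU := (contMDiffAt_mvfderiv_apply (S.contMDiffAt_factor hH p) hU).mdifferentiableAt
    (n := ∞) (by simp)
  have hcU := (S.contMDiffAt_connForm hH hU).mdifferentiableAt (n := ∞) (by simp)
  have hf := S.mdiff_factor hH p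
  -- The formula `∇_U ξ = (df(U) - f ω(U)) L` is differentiated along `L`, which is parallel along
  -- itself.
  have h1 := nablaAlong_nabla (g := g) hs hdU (S.L p)
  have ha : MDifferentiableAt (𝓡 3) 𝓘(ℝ, ℝ) (fun q ↦ mvfderiv (𝓡 3) (S.factor ξ) q (U q)
      + - (S.factor ξ q * S.connForm q (U q))) p := hfU.add (hf.mul hcU).neg
  rw [nablaAlong_congr (W := fun q ↦ (mvfderiv (𝓡 3) (S.factor ξ) q (U q)
      + - (S.factor ξ q * S.connForm q (U q))) • S.LM q)
      (Filter.Eventually.of_forall fun q ↦ by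
        rw [← sub_eq_add_neg]; exact S.nabla_killing_push hH q (U q)),
    nablaAlong_smul ha (S.diffAlongAt_LM hH.hypersurface p), nablaAlong_LM_L, smul_zero, add_zero,
    S.nablaAlong_push_L hH hU, map_add, map_smul, S.nabla_killing_push hH,
    S.nabla_killing_LM hH] at h1
  have h2 := congrArg (fun z ↦ g.val (ι p) z (S.Lbar p)) h1
  have h3 := S.val_hess_LM_left hH p (push ι p (U p)) (S.Lbar p)
  rw [LM] at h3
  simp only [map_add, map_smul, _root_.add_apply, _root_.smul_apply, S.val_LM_Lbar, h3,
    smul_eq_mul] at h2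
  -- Here `L(df(U)) - df([L, U]) = U(L f) = dκ(U)`, and the two occurrences of `κ ω(U)` cancel.
  rw [mvfderiv_add_apply (h := fun q ↦ -(S.factor ξ q * S.connForm q (U q))) hfU (hf.mul hcU).neg,
    mvfderiv_neg_apply, mvfderiv_mul_apply hf hcU,
    mvfderiv_mlieBracket_of_smooth (S.contMDiffAt_factor hH p) (S.L_smooth p) hU,
    ← funext (S.surfaceGravity_eq hH hκ)] at h2
  linarith

lemma lie1_zeta (p : H) {u : TangentSpace (𝓡 3) p} (hu : S.Tangent p u) :
    S.lie1 S.zeta p u = - S.beta p (push ι p u) := by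
  have h := S.factor_mul_lie_connForm hH hκ (hSmoothAt_extend u)
  rw [FiberBundle.extend_apply_self, S.mvfderiv_surfaceGravity_of_tangent hH hκ p hu] at h
  rw [lie1]
  simp only [S.zeta_push hH]
  refine mul_left_cancel₀ (S.factor_ne_zero hH p) (h.trans ?_)
  ring

lemma nabla1_zeta (p : H) {u : TangentSpace (𝓡 3) p} (hu : S.Tangent p u) :
    S.nabla1 S.zeta p u = - S.beta p (push ι p u) := by
  rw [← S.lie1_zeta hH hκ p hu, lie1, nabla1, zeta, zeta,
    S.proj_nablaAlong_push_L hH (hSmoothAt_extend u)]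

end GeodesicFoliation

/-- A function whose derivative along a vector field vanishes is constant along its integral
curves. -/
lemma IsMIntegralCurveOn.apply_eq {E B N : Type*} [NormedAddCommGroup E] [NormedSpace ℝ E]
    [TopologicalSpace B] {I : ModelWithCorners ℝ E B} [TopologicalSpace N] [ChartedSpace B N]
    {X : ∀ q : N, TangentSpace I q} {γ : ℝ → N} {s : Set ℝ} (hγ : IsMIntegralCurveOn γ X s)
    (hs : Convex ℝ s) {h : N → ℝ} (hh : ∀ q, MDifferentiableAt I 𝓘(ℝ, ℝ) h q)
    (h0 : ∀ q, mvfderiv I h q (X q) = 0) {a b : ℝ} (ha : a ∈ s) (hb : b ∈ s) :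
    h (γ a) = h (γ b) := by
  have hd : ∀ t ∈ s, HasFDerivWithinAt (h ∘ γ) (0 : ℝ →L[ℝ] ℝ) s t := by
    intro t ht
    have h1 := (hh (γ t)).hasMFDerivAt.comp_hasMFDerivWithinAt t (hγ t ht)
    have h2 : (mfderiv I 𝓘(ℝ, ℝ) h (γ t)).comp ((1 : ℝ →L[ℝ] ℝ).smulRight (X (γ t))) = 0 := by
      ext
      exact (congrArg _ (one_smul ℝ (X (γ t)))).trans (h0 (γ t))
    exact h1.hasFDerivWithinAt.congr_fderiv h2
  have := hs.norm_image_sub_le_of_norm_hasFDerivWithin_le (C := 0) hd (by simp) hb ha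
  rw [zero_mul, norm_le_zero_iff, sub_eq_zero] at this
  exact this

/-! ### Fields tangent to the leaves and the conjugate second fundamental form -/

namespace GeodesicFoliation

open LorentzMetric VectorField

variable {M : Type*} [TopologicalSpace M] [ChartedSpace E4 M] [IsManifold (𝓡 4) ∞ M]
  {H : Type*} [TopologicalSpace H] [ChartedSpace E3 H] [IsManifold (𝓡 3) ∞ H]
  {g : LorentzMetric M} {ι : H → M} (S : GeodesicFoliation g ι)

lemma mdiff_v (p : H) : MDifferentiableAt (𝓡 3) 𝓘(ℝ, ℝ) S.v p :=
  (S.v_smooth p).mdifferentiableAt (by simp)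

/-- The Lie bracket with `L` commutes with `dv`. -/
lemma mvfderiv_v_mlieBracket {p : H} {U : ∀ p : H, TangentSpace (𝓡 3) p} (hU : HSmoothAt U p) :
    mvfderiv (𝓡 3) S.v p (mlieBracket (𝓡 3) S.L U p)
      = mvfderiv (𝓡 3) (fun q ↦ mvfderiv (𝓡 3) S.v q (U q)) p (S.L p) := by
  rw [mvfderiv_mlieBracket_of_smooth (S.v_smooth p) (S.L_smooth p) hU, funext S.L_v,
    mvfderiv_const]
  simp

/-- The projection of a vector field to the leaves, along `L`. -/
def leafField (U : ∀ p : H, TangentSpace (𝓡 3) p) : ∀ p : H, TangentSpace (𝓡 3) p :=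
  U + (fun q ↦ - mvfderiv (𝓡 3) S.v q (U q)) • S.L

lemma leafField_eq_proj {U : ∀ p : H, TangentSpace (𝓡 3) p} {p : H}
    (hι : Function.Injective (push ι p)) : S.leafField U p = S.proj p (push ι p (U p)) := by
  rw [S.proj_push hι, sub_eq_add_neg, ← neg_smul]
  rfl

lemma tangent_leafField (U : ∀ p : H, TangentSpace (𝓡 3) p) (p : H) :
    S.Tangent p (S.leafField U p) := by
  change mvfderiv (𝓡 3) S.v p (U p + (- mvfderiv (𝓡 3) S.v p (U p)) • S.L p) = 0
  rw [map_add, map_smul, S.L_v]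
  simp

lemma hSmoothAt_leafField {p : H} {U : ∀ p : H, TangentSpace (𝓡 3) p} (hU : HSmoothAt U p) :
    HSmoothAt (S.leafField U) p :=
  ContMDiffAt.add_section hU
    (ContMDiffAt.smul_section (contMDiffAt_mvfderiv_apply (S.v_smooth p) hU).neg (S.L_smooth p))

/-- The subtracted multiple of `L` contributes `L(dv(U)) L`, and `L(dv(U)) = dv([L, U])` is exactly
the coefficient that the projection removes. -/
lemma mlieBracket_leafField {p : H} {U : ∀ p : H, TangentSpace (𝓡 3) p} (hU : HSmoothAt U p)
    (hι : Function.Injective (push ι p)) :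
    mlieBracket (𝓡 3) S.L (S.leafField U) p
      = S.proj p (push ι p (mlieBracket (𝓡 3) S.L U p)) := by
  have hv : MDifferentiableAt (𝓡 3) 𝓘(ℝ, ℝ) (fun q ↦ - mvfderiv (𝓡 3) S.v q (U q)) p :=
    (contMDiffAt_mvfderiv_apply (S.v_smooth p) hU).neg.mdifferentiableAt (by simp)
  have hL := hDiffAt (S.L_smooth p)
  rw [S.proj_push hι, S.mvfderiv_v_mlieBracket hU, leafField,
    mlieBracket_add_right (hDiffAt hU) (hv.smul_section hL), mlieBracket_smul_right hv hL,
    mvfderiv_neg_apply]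
  simp [sub_eq_add_neg]

lemma val_nablaAlong_Lbar_LM (hN : IsNullHypersurface g ι) (p : H) (u : TangentSpace (𝓡 3) p) :
    g.val (ι p) (nablaAlong g ι S.Lbar p u) (S.LM p) = - S.connForm p u := by
  have h := mvfderiv_val (g := g) (S.diffAlongAt_LM hN p) (S.diffAlongAt_Lbar p) u
  rw [funext S.val_LM_Lbar, mvfderiv_const, g.symm _ (S.LM p)] at h
  exact eq_neg_of_add_eq_zero_right h.symm

/-- Differentiates `g(Lbar, W) = 0`; this is why `W` must be tangent to the leaves everywhere and
not just at `p`. -/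
lemma val_nablaAlong_Lbar_push (hN : IsNullHypersurface g ι) {p : H}
    {W : ∀ p : H, TangentSpace (𝓡 3) p} (hW : HSmoothAt W p) (hW' : ∀ q, S.Tangent q (W q))
    (u : TangentSpace (𝓡 3) p) :
    g.val (ι p) (nablaAlong g ι S.Lbar p u) (push ι p (W p))
      = - g.val (ι p) (nablaAlong g ι (fun q ↦ push ι q (W q)) p u) (S.Lbar p) := by
  have h := mvfderiv_val (g := g) (S.diffAlongAt_Lbar p)
    (diffAlongAt_of_smoothAlongAt (smoothAlongAt_push (hN.smooth p) hW)) u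
  rw [funext fun q ↦ S.Lbar_normal q (W q) (hW' q), mvfderiv_const, g.symm _ (S.Lbar p)] at h
  exact eq_neg_of_add_eq_zero_left h.symm

section Killing

variable {ξ : ∀ x : M, TangentSpace (𝓡 4) x} (hH : IsKillingHorizon g ι ξ)

include hH

/-- For a leaf field `W`, the derivative moves to `∇_L W = [L, W] - ω(W) L`, where the bracket stays
tangent to the leaves and is orthogonal to `Lbar`. The `L`-component of `w` contributes nothing, as
`ω(L) = 0`. -/
lemma val_nablaAlong_Lbar_L (p : H) (w : TangentSpace (𝓡 3) p) :
    g.val (ι p) (nablaAlong g ι S.Lbar p (S.L p)) (push ι p w) = - S.connForm p w := by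
  have hN := hH.hypersurface
  have hw := hSmoothAt_extend w
  have h := S.val_nablaAlong_Lbar_push hN (S.hSmoothAt_leafField hw) (S.tangent_leafField _) (S.L p)
  have hv : mvfderiv (𝓡 3) S.v p (mlieBracket (𝓡 3) S.L (S.leafField (FiberBundle.extend E3 w)) p)
      = 0 := by
    rw [S.mvfderiv_v_mlieBracket (S.hSmoothAt_leafField hw),
      funext fun q ↦ (S.tangent_leafField _ q : mvfderiv (𝓡 3) S.v q _ = 0), mvfderiv_const]
    rfl
  rw [S.nablaAlong_push_L hH (S.hSmoothAt_leafField hw), map_add, _root_.add_apply, val_push_Lbar,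
    hv, S.leafField_eq_proj (hN.immersion p), FiberBundle.extend_apply_self, map_smul,
    _root_.smul_apply, val_LM_Lbar, S.connForm_proj hH, S.proj_push (hN.immersion p), map_sub,
    map_smul, map_sub, map_smul] at h
  have h' := S.val_nablaAlong_Lbar_LM hN p (S.L p)
  rw [LM, connForm_L] at h'
  rw [h'] at h
  simpa using h

variable {κ : H → ℝ} (hκ : ∀ p : H, g.nabla ξ (ι p) (ξ (ι p)) = κ p • ξ (ι p))

include hκ

/-- `L(f - c v) = κ - c = 0`, so `f - c v` is constant along each generator; where it meets the
initial section, `f = 1` and `v = 0`. -/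
lemma factor_eq_of_const {c : ℝ} (hc : ∀ p, κ p = c)
    (h0 : ∀ p : H, S.v p = 0 → S.LM p = ξ (ι p)) (p : H) : S.factor ξ p = 1 + c * S.v p := by
  obtain ⟨γ, t, hγ, rfl, ht⟩ := S.generator p
  have hv : ∀ q, MDifferentiableAt (𝓡 3) 𝓘(ℝ, ℝ) (fun q ↦ -c * S.v q) q :=
    fun q ↦ mdifferentiableAt_const.mul (S.mdiff_v q)
  have h := hγ.apply_eq (convex_uIcc 0 t) (h := fun q ↦ S.factor ξ q + -c * S.v q)
    (fun q ↦ (S.mdiff_factor hH q).add (hv q)) (fun q ↦ by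
      rw [mvfderiv_add_apply (S.mdiff_factor hH q) (hv q),
        mvfderiv_mul_apply (f := fun _ ↦ -c) mdifferentiableAt_const (S.mdiff_v q),
        ← S.surfaceGravity_eq hH hκ, hc, S.L_v, mvfderiv_const]
      simp) Set.left_mem_uIcc Set.right_mem_uIcc
  have hf : S.factor ξ (γ t) = 1 := by
    rw [factor, ← h0 _ ht, val_LM_Lbar, neg_neg]
  simp only [hf, ht] at h
  linarith

lemma mvfderiv_factor_of_const {c : ℝ} (hc : ∀ p, κ p = c)
    (h0 : ∀ p : H, S.v p = 0 → S.LM p = ξ (ι p)) (p : H) (u : TangentSpace (𝓡 3) p) :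
    mvfderiv (𝓡 3) (S.factor ξ) p u = c * mvfderiv (𝓡 3) S.v p u := by
  rw [funext (S.factor_eq_of_const hH hκ hc h0),
    mvfderiv_add_apply (f := fun _ ↦ 1) (h := fun q ↦ c * S.v q) mdifferentiableAt_const
      (mdifferentiableAt_const.mul (S.mdiff_v p)),
    mvfderiv_mul_apply (f := fun _ ↦ c) mdifferentiableAt_const (S.mdiff_v p), mvfderiv_const,
    mvfderiv_const]
  simp

/-- The Lie derivative along `L` of the conjugate null second fundamental form, for vector fields
tangent to the leaves. -/
lemma mvfderiv_val_nablaAlong_Lbar {c : ℝ} (hc : ∀ p, κ p = c)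
    (h0 : ∀ p : H, S.v p = 0 → S.LM p = ξ (ι p)) {p : H}
    {U W : ∀ p : H, TangentSpace (𝓡 3) p} (hU : HSmoothAt U p) (hW : HSmoothAt W p)
    (hU' : ∀ q, S.Tangent q (U q)) (hW' : ∀ q, S.Tangent q (W q)) :
    S.factor ξ p * (mvfderiv (𝓡 3)
          (fun q ↦ g.val (ι q) (nablaAlong g ι S.Lbar q (U q)) (push ι q (W q))) p (S.L p)
        - g.val (ι p) (nablaAlong g ι S.Lbar p (mlieBracket (𝓡 3) S.L U p)) (push ι p (W p))
        - g.val (ι p) (nablaAlong g ι S.Lbar p (U p)) (push ι p (mlieBracket (𝓡 3) S.L W p)))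
      = c * g.val (ι p) (nablaAlong g ι S.Lbar p (U p)) (push ι p (W p)) := by
  have hN := hH.hypersurface
  have hs := hH.killing.smoothAt (ι p)
  have hpW := smoothAlongAt_push (hN.smooth p) hW
  have dW := diffAlongAt_of_smoothAlongAt hpW
  have hzW := (S.contMDiffAt_connForm hH hW).mdifferentiableAt (n := ∞) (by simp)
  have hf := S.mdiff_factor hH p
  have dLM := S.diffAlongAt_LM hN p
  have hdf : ∀ q (y : TangentSpace (𝓡 3) q), S.Tangent q y →
      mvfderiv (𝓡 3) (S.factor ξ) q y = 0 := by
    intro q y hy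
    rw [S.mvfderiv_factor_of_const hH hκ hc h0, show mvfderiv (𝓡 3) S.v q y = 0 from hy, mul_zero]
  -- `∇_U W` is tangent to the horizon
  obtain ⟨y, hy⟩ : ∃ y, nablaAlong g ι (fun q ↦ push ι q (W q)) p (U p) = push ι p y := by
    refine S.exists_eq_push (hN.immersion p) ?_
    have := S.val_nablaAlong_LM_eq_neg hN hW (U p)
    rw [S.val_nablaAlong_LM_push hH] at this
    linarith
  -- The `L`-component of `∇_U W` is the conjugate second fundamental form; through `df = c dv` it
  -- is the source of the right-hand side.
  have hvy : mvfderiv (𝓡 3) S.v p y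
      = g.val (ι p) (nablaAlong g ι S.Lbar p (U p)) (push ι p (W p)) := by
    rw [S.val_nablaAlong_Lbar_push hN hW hW', hy, val_push_Lbar, neg_neg]
  -- the derivative along `L`
  have h1 := mvfderiv_val (g := g) (diffAlongAt_of_smoothAlongAt
    (smoothAlongAt_nablaAlong (g := g) (S.Lbar_smooth p) hU)) dW (S.L p)
  rw [S.nablaAlong_push_L hH hW, map_add, map_smul, S.val_nablaAlong_Lbar_LM hN, smul_eq_mul] at h1
  -- The commutator trades `∇_L ∇_U Lbar` for `∇_U ∇_L Lbar`, a bracket term and a curvature.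
  have h2 := congrArg (fun z ↦ g.val (ι p) z (push ι p (W p)))
    (nablaAlong_commutator (g := g) (S.Lbar_smooth p) (S.L_smooth p) hU)
  simp only [map_sub, _root_.sub_apply] at h2
  -- `∇_U ∇_L Lbar`
  have h3 := mvfderiv_val (g := g) (diffAlongAt_of_smoothAlongAt
    (smoothAlongAt_nablaAlong (g := g) (S.Lbar_smooth p) (S.L_smooth p))) dW (U p)
  rw [funext fun q ↦ S.val_nablaAlong_Lbar_L hH q (W q), hy, S.val_nablaAlong_Lbar_L hH,
    mvfderiv_neg_apply] at h3
  -- `∇_U (∇_W ξ)`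
  have h4 := nablaAlong_nabla (g := g) hs dW (U p)
  rw [nablaAlong_congr (W := fun q ↦ (-(S.factor ξ q * S.connForm q (W q))) • S.LM q)
      (Filter.Eventually.of_forall fun q ↦ by
        rw [S.nabla_killing_push hH, hdf q _ (hW' q), zero_sub]),
    nablaAlong_smul (f := fun q ↦ -(S.factor ξ q * S.connForm q (W q))) (hf.mul hzW).neg dLM,
    S.nablaAlong_LM hH, hy, S.nabla_killing_push hH,
    mvfderiv_neg_apply, mvfderiv_mul_apply hf hzW, hdf p _ (hU' p),
    S.mvfderiv_factor_of_const hH hκ hc h0, hvy] at h4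
  have h5 := congrArg (fun z ↦ g.val (ι p) z (S.Lbar p)) h4
  simp only [map_add, map_smul, _root_.add_apply, _root_.smul_apply, S.val_LM_Lbar,
    smul_eq_mul, hH.killing.val_hess] at h5
  -- Pair symmetry brings the curvature from the Killing Hessian to the form occurring in the
  -- commutator.
  rw [S.eq_factor_smul hH p, riemann_smul_second, riemann_pair_symm, riemann_swap_right] at h5
  have h6 : g.riemann (ι p) (push ι p (W p)) (S.Lbar p) (S.LM p) (push ι p (U p))
      = g.val (ι p) (g.curvature (ι p) (push ι p (S.L p)) (push ι p (U p)) (S.Lbar p))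
        (push ι p (W p)) := rfl
  rw [h6] at h5
  rw [h1]
  -- The curvatures, the terms `U(ω(W))`, `ω(∇_U W)` and the products `ω(U) ω(W)` cancel.
  linear_combination S.factor ξ p * h2 - S.factor ξ p * h3 - h5

/-- `chibar` projects its arguments, so the extensions of `u` and `w` may be replaced by leaf fields
without changing any term of the Lie derivative. -/
lemma lie2_chibar {c : ℝ} (hc : ∀ p, κ p = c)
    (h0 : ∀ p : H, S.v p = 0 → S.LM p = ξ (ι p)) (p : H) (u w : TangentSpace (𝓡 3) p) :
    S.lie2 S.chibar p u w = c / S.factor ξ p * S.chibar p (push ι p u) (push ι p w) := by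
  have hi := hH.hypersurface.immersion
  have hu := hSmoothAt_extend u
  have hw := hSmoothAt_extend w
  have h := S.mvfderiv_val_nablaAlong_Lbar hH hκ hc h0 (S.hSmoothAt_leafField hu)
    (S.hSmoothAt_leafField hw) (S.tangent_leafField _) (S.tangent_leafField _)
  rw [S.mlieBracket_leafField hu (hi p), S.mlieBracket_leafField hw (hi p)] at h
  simp only [S.leafField_eq_proj (hi _), FiberBundle.extend_apply_self] at h
  rw [div_mul_eq_mul_div, eq_div_iff (S.factor_ne_zero hH p), mul_comm]
  exact h

lemma nabla2_chibar {c : ℝ} (hc : ∀ p, κ p = c)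
    (h0 : ∀ p : H, S.v p = 0 → S.LM p = ξ (ι p)) (p : H) (u w : TangentSpace (𝓡 3) p) :
    S.nabla2 S.chibar p u w = c / S.factor ξ p * S.chibar p (push ι p u) (push ι p w) := by
  rw [← S.lie2_chibar hH hκ hc h0]
  simp only [lie2, nabla2, chibar, S.proj_nablaAlong_push_L hH (hSmoothAt_extend _)]

end Killing

end GeodesicFoliation

end

theorem lemma1 {M : Type*} [TopologicalSpace M] [ChartedSpace E4 M] [IsManifold (𝓡 4) ∞ M]
    {H : Type*} [TopologicalSpace H] [ChartedSpace E3 H] [IsManifold (𝓡 3) ∞ H]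
    (g : LorentzMetric M) (ι : H → M) (ξ : ∀ x : M, TangentSpace (𝓡 4) x) (κ : H → ℝ)
    (hH : IsKillingHorizon g ι ξ)
    (hκ : ∀ p : H, g.nabla ξ (ι p) (ξ (ι p)) = κ p • ξ (ι p))
    (S : GeodesicFoliation g ι) :
    (∀ (p : H) (u w : TangentSpace (𝓡 3) p), S.Tangent p u → S.Tangent p w →
      S.chi p (push ι p u) (push ι p w) = 0) ∧
    (∀ (p : H) (u w : TangentSpace (𝓡 3) p), S.Tangent p u → S.Tangent p w →
      S.lie2 S.gslash p u w = 0) ∧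
    (∀ p : H, MDifferentiableAt (𝓡 3) 𝓘(ℝ, ℝ) κ p ∧
      ∀ u : TangentSpace (𝓡 3) p, S.Tangent p u →
        mvfderiv (𝓡 3) κ p u = g.val (ι p) (ξ (ι p)) (S.Lbar p) * S.beta p (push ι p u)) ∧
    (∀ (p : H) (u : TangentSpace (𝓡 3) p), S.Tangent p u →
      S.lie1 S.zeta p u = -S.beta p (push ι p u) ∧
      S.nabla1 S.zeta p u = -S.beta p (push ι p u)) ∧
    ((∀ p : H, S.v p = 0 → S.LM p = ξ (ι p)) → (∃ c : ℝ, ∀ p : H, κ p = c) →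
      ∃ f : H → ℝ, (∀ p : H, f p ≠ 0 ∧ ξ (ι p) = f p • S.LM p) ∧
        ∀ (p : H) (u w : TangentSpace (𝓡 3) p), S.Tangent p u → S.Tangent p w →
          S.lie2 S.chibar p u w = κ p / f p * S.chibar p (push ι p u) (push ι p w) ∧
          S.nabla2 S.chibar p u w = κ p / f p * S.chibar p (push ι p u) (push ι p w)) := by
  refine ⟨fun p u w _ _ ↦ S.chi_eq_zero hH p _ _, fun p u w _ _ ↦ S.lie2_gslash hH p u w,
    fun p ↦ ⟨(S.contMDiffAt_surfaceGravity hH hκ p).mdifferentiableAt (by simp), fun u hu ↦ ?_⟩,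
    fun p u hu ↦ ⟨S.lie1_zeta hH hκ p hu, S.nabla1_zeta hH hκ p hu⟩, ?_⟩
  · rw [S.mvfderiv_surfaceGravity_of_tangent hH hκ p hu, GeodesicFoliation.factor, neg_neg]
  · rintro h0 ⟨c, hc⟩
    refine ⟨S.factor ξ, fun p ↦ ⟨S.factor_ne_zero hH p, S.eq_factor_smul hH p⟩,
      fun p u w _ _ ↦ ?_⟩
    rw [hc p]
    exact ⟨S.lie2_chibar hH hκ hc h0 p u w, S.nabla2_chibar hH hκ hc h0 p u w⟩
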